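/- Consider algebras $\mathbf A=\langle A,\lor,\land,{}^*,{}',0,1\rangle$ of type $(2,2,1,1,0,0)$ whose reduct $\langle A,\lor,\land,0,1\rangle$ is a bounded distributive lattice. Such an $\mathbf A$ is an *Almost Gautama algebra* if it satisfies - (Stone algebra) $0^*=1$, $1^*=0$, $(x\lor y)^*=x^*\land y^*$, $(x\land y)^{**}=x^{**}\land y^{**}$, $x\le x^{**}$, $x^*\land x^{**}=0$, $x^*\lor x^{**}=1$; - (dually quasi-De Morgan algebra) $0'=1$, $1'=0$, $(x\land y)'=x'\lor y'$, $(x\lor y)''=x''\lor y''$, $x''\le x$; - (R1) $x\land x'{}^{*}{}'\le y\lor y^*$; - $x^{*}{}''=x^*$; - (L1) $(x\land x'{}^*)'{}^*=x\land x'{}^*$. Let $\mathbb{AG}$ be the variety of Almost Gautama algebras, and consider the following classes of algebras of the same type: - $\mathbb{BA}$: Boolean algebras, i.e. $x\land x^*=0$, $x\lor x^*=1$ and $x'=x^*$ for all $x$; - $\mathbb{RDBLS}\mathrm t$: regular double Stone algebras, i.e. $\langle A,\lor,\land,{}^*,0,1\rangle$ is a Stone algebra, $\langle A,\lor,\land,{}',0,1\rangle$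 is a dual Stone algebra (it satisfies the order duals of the Stone algebra identities above), and $x\land x'\le y\lor y^*$; - $\mathbb{RKLS}\mathrm t$: regular Kleene Stone algebras, i.e. $\langle A,\lor,\land,{}^*,0,1\rangle$ is a Stone algebra, $\langle A,\lor,\land,{}',0,1\rangle$ is a Kleene algebra ($0'=1$, $1'=0$, $(x\land y)'=x'\lor y'$, $x''=x$, $x\land x'\le y\lor y'$), and (R1) holds; - $\mathbb{DMBA}$: De Morgan Boolean algebras, i.e. the variety generated by the algebra $\mathbf 4_{\mathbf{dmba}}$ on the four-element Boolean lattice $\{0,a,b,1\}$ in which ${}^*$ is the Boolean complement and $0'=1$, $1'=0$, $a'=a$, $b'=b$. A variety $\mathbb V$ has the *transferability property* (TP) if for all $\mathbf A,\mathbf B,\mathbf C\in\mathbb V$, every embedding $f:\mathbf A\to\mathbf B$ and every homomorphism $g:\mathbf A\to\mathbf C$, there exist $\mathbf D\in\mathbb V$, a homomorphism $f_1:\mathbf B\to\mathbf D$ and an embedding $g_1:\mathbf C\to\mathbf D$ such that $f_1f=g_1g$. **Corollary.** Let $\mathbb V$ be a nontrivial subvariety of $\mathbb{AG}$ (a variety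 contained in $\mathbb{AG}$ that has a member with more than one element). Then $\mathbb V$ has (TP) if and only if $\mathbb V\in\{\mathbb{BA},\mathbb{RDBLS}\mathrm t,\mathbb{RKLS}\mathrm t,\mathbb{DMBA}\}$. -/

import Mathlib

universe u v

namespace AlmostGautama

/-- Algebras `⟨A, ∨, ∧, *, ', 0, 1⟩` of type `(2, 2, 1, 1, 0, 0)` whose reduct
`⟨A, ∨, ∧, 0, 1⟩` is a bounded distributive lattice; `*` and `'` are arbitrary unary operations. -/
structure Alg : Type (u + 1) where
  carrier : Type u
  [lattice : DistribLattice carrier]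
  [bounded : BoundedOrder carrier]
  star : carrier → carrier
  prime : carrier → carrier

namespace Alg

instance : CoeSort Alg.{u} (Type u) := ⟨Alg.carrier⟩

attribute [instance] Alg.lattice Alg.bounded

end Alg

/-- Homomorphisms: maps preserving `∨, ∧, 0, 1, *, '`. -/
structure Hom (A : Alg.{u}) (B : Alg.{v}) extends BoundedLatticeHom A B where
  map_star' : ∀ x : A, toFun (A.star x) = B.star (toFun x)
  map_prime' : ∀ x : A, toFun (A.prime x) = B.prime (toFun x)

instance (A : Alg.{u}) (B : Alg.{v}) : CoeFun (Hom A B) (fun _ => A → B) := ⟨fun f => f.toFun⟩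

/-- The direct product of a family of algebras, with coordinatewise operations. -/
def Alg.pi {ι : Type u} (A : ι → Alg.{u}) : Alg.{u} where
  carrier := ∀ i, A i
  star x := fun i => (A i).star (x i)
  prime x := fun i => (A i).prime (x i)

/-- A variety: a class of algebras closed under homomorphic images, (isomorphic copies of)
subalgebras and direct products. -/
structure IsVariety (V : Set Alg.{u}) : Prop where
  image_mem : ∀ (A B : Alg.{u}) (f : Hom A B), Function.Surjective f → A ∈ V → B ∈ V
  sub_mem : ∀ (A B : Alg.{u}) (f : Hom A B), Function.Injective f → B ∈ V → A ∈ V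
  pi_mem : ∀ (ι : Type u) (A : ι → Alg.{u}), (∀ i, A i ∈ V) → Alg.pi A ∈ V

/-- The variety generated by a class `K`: the smallest variety containing `K`. -/
def varietyGenerated (K : Set Alg.{u}) : Set Alg.{u} :=
  {A | ∀ V : Set Alg.{u}, IsVariety V → K ⊆ V → A ∈ V}

/-- A class is nontrivial if it has a member with at least two elements. -/
def IsNontrivialClass (V : Set Alg.{u}) : Prop := ∃ A ∈ V, Nontrivial A

/-- `⟨A, ∨, ∧, *, 0, 1⟩` is a Stone algebra. -/
structure IsStone (A : Alg.{u}) : Prop where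
  star_bot : A.star ⊥ = ⊤
  star_top : A.star ⊤ = ⊥
  star_sup : ∀ x y : A, A.star (x ⊔ y) = A.star x ⊓ A.star y
  star_star_inf : ∀ x y : A,
    A.star (A.star (x ⊓ y)) = A.star (A.star x) ⊓ A.star (A.star y)
  le_star_star : ∀ x : A, x ≤ A.star (A.star x)
  star_inf_star_star : ∀ x : A, A.star x ⊓ A.star (A.star x) = ⊥
  star_sup_star_star : ∀ x : A, A.star x ⊔ A.star (A.star x) = ⊤

/-- `⟨A, ∨, ∧, ', 0, 1⟩` is a dual Stone algebra (with `'` as the dual pseudocomplement `⁺`). -/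
structure IsDualStone (A : Alg.{u}) : Prop where
  prime_top : A.prime ⊤ = ⊥
  prime_bot : A.prime ⊥ = ⊤
  prime_inf : ∀ x y : A, A.prime (x ⊓ y) = A.prime x ⊔ A.prime y
  prime_prime_sup : ∀ x y : A,
    A.prime (A.prime (x ⊔ y)) = A.prime (A.prime x) ⊔ A.prime (A.prime y)
  prime_prime_le : ∀ x : A, A.prime (A.prime x) ≤ x
  prime_sup_prime_prime : ∀ x : A, A.prime x ⊔ A.prime (A.prime x) = ⊤
  prime_inf_prime_prime : ∀ x : A, A.prime x ⊓ A.prime (A.prime x) = ⊥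

/-- `⟨A, ∨, ∧, ', 0, 1⟩` is a Kleene algebra. -/
structure IsKleene (A : Alg.{u}) : Prop where
  prime_bot : A.prime ⊥ = ⊤
  prime_top : A.prime ⊤ = ⊥
  prime_inf : ∀ x y : A, A.prime (x ⊓ y) = A.prime x ⊔ A.prime y
  prime_prime : ∀ x : A, A.prime (A.prime x) = x
  kleene : ∀ x y : A, x ⊓ A.prime x ≤ y ⊔ A.prime y

/-- `⟨A, ∨, ∧, ', 0, 1⟩` is a dually quasi-De Morgan algebra. -/
structure IsDuallyQuasiDeMorgan (A : Alg.{u}) : Prop where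
  prime_bot : A.prime ⊥ = ⊤
  prime_top : A.prime ⊤ = ⊥
  prime_inf : ∀ x y : A, A.prime (x ⊓ y) = A.prime x ⊔ A.prime y
  prime_prime_sup : ∀ x y : A,
    A.prime (A.prime (x ⊔ y)) = A.prime (A.prime x) ⊔ A.prime (A.prime y)
  prime_prime_le : ∀ x : A, A.prime (A.prime x) ≤ x

/-- The regularity identity (R1): `x ∧ x'*' ≤ y ∨ y*`. -/
def IsRegular (A : Alg.{u}) : Prop :=
  ∀ x y : A, x ⊓ A.prime (A.star (A.prime x)) ≤ y ⊔ A.star y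

/-- The class of Almost Gautama algebras. -/
def AG : Set Alg.{u} :=
  {A | IsStone A ∧ IsDuallyQuasiDeMorgan A ∧ IsRegular A ∧
    (∀ x : A, A.prime (A.prime (A.star x)) = A.star x) ∧
    (∀ x : A, A.star (A.prime (x ⊓ A.star (A.prime x))) = x ⊓ A.star (A.prime x))}

/-- Boolean algebras: both `*` and `'` are the Boolean complement. -/
def BA : Set Alg.{u} := {A | ∀ x : A, IsCompl x (A.star x) ∧ A.prime x = A.star x}

/-- Regular double Stone algebras, with `'` in the role of the dual pseudocomplement `⁺`;
the last clause is the regularity identity `x ∧ x⁺ ≤ y ∨ y*`. -/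
def RDBLSt : Set Alg.{u} :=
  {A | IsStone A ∧ IsDualStone A ∧ ∀ x y : A, x ⊓ A.prime x ≤ y ⊔ A.star y}

/-- Regular Kleene Stone algebras. -/
def RKLSt : Set Alg.{u} := {A | IsStone A ∧ IsKleene A ∧ IsRegular A}

/-- The four-element algebra with atoms `a = (true, false)` and `b = (false, true)`, in which
`*` is the Boolean complement, `0' = 1`, `1' = 0`, `a' = a` and `b' = b`. -/
def fourDMBA : Alg.{0} where
  carrier := Bool × Bool
  star x := (!x.1, !x.2)
  prime x := (!x.2, !x.1)

/-- De Morgan Boolean algebras: the variety generated by (the isomorphic copies of)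
the four-element algebra above. -/
def DMBA : Set Alg.{u} :=
  varietyGenerated {A | ∃ f : Hom A fourDMBA, Function.Bijective f}

/-- The transferability property. -/
def HasTP (V : Set Alg.{u}) : Prop :=
  ∀ A ∈ V, ∀ B ∈ V, ∀ C ∈ V, ∀ f : Hom A B, Function.Injective f → ∀ g : Hom A C,
    ∃ D ∈ V, ∃ (f₁ : Hom B D) (g₁ : Hom C D), Function.Injective g₁ ∧
      ∀ x : A, f₁ (f x) = g₁ (g x)

end AlmostGautama

-- There are four nontrivial simple almost Gautama algebras: `two`, `threeDS`, `threeKS` and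
-- `fourDMBA`. Each of the four classes consists exactly of the algebras whose points are separated
-- by homomorphisms into the corresponding simple algebra `S`.
--
-- For sufficiency, `S` is injective in its class. A homomorphism into `S` is determined by a single
-- prime filter of the lattice reduct, every prime filter gives such a homomorphism, and prime
-- filters extend along embeddings (`exists_boolHom_extension`). A span is then completed by the
-- power of `S` indexed by all homomorphisms `C → S` (`hasTP_of_separated`).
--
-- For necessity, central elements give enough quotients in which `x ∧ x'* = 0` for `x ≠ 1`
-- (`AG.exists_simple_quotient`), and `AG.classification` identifies these with the four algebras.
-- Hence every algebra in a variety below `AG` is separated by its homomorphisms to the simple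
-- algebras in that variety. If two of these, `S` and `T`, differ from `two`, then (TP) applied to
-- `S ← two → T` gives a nontrivial `D`. A homomorphism from `D` to some simple `R` yields `S → R`
-- and `T → R`, which forces `S = R = T` (`IsBasic.eq_of_hom`). So at most one simple algebra
-- besides `two` occurs, and it determines the variety (`eq_of_lift_mem`).

universe w

namespace AlmostGautama

/-! ### Separation by lattice homomorphisms to `Bool` -/

/-- The prime ideal theorem, applied to the filter generated by `F` and the ideal generated by `I`.
The homomorphism is the indicator of the complement of the prime ideal. -/
theorem exists_boolHom_of_sets {α : Type*} [DistribLattice α] [BoundedOrder α] (F I : Set α)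
    (hF : F.Nonempty) (hFi : ∀ a ∈ F, ∀ b ∈ F, a ⊓ b ∈ F)
    (hI : I.Nonempty) (hIs : ∀ a ∈ I, ∀ b ∈ I, a ⊔ b ∈ I)
    (hFI : ∀ a ∈ F, ∀ b ∈ I, ¬ a ≤ b) :
    ∃ φ : BoundedLatticeHom α Bool, (∀ a ∈ F, φ a = true) ∧ ∀ b ∈ I, φ b = false := by
  classical
  have hFF : Order.IsPFilter {x | ∃ a ∈ F, a ≤ x} := by
    refine Order.IsPFilter.of_def ?_ ?_ ?_
    · obtain ⟨a, ha⟩ := hF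
      exact ⟨a, a, ha, le_rfl⟩
    · rintro x ⟨a, ha, hax⟩ y ⟨b, hb, hby⟩
      exact ⟨a ⊓ b, ⟨a ⊓ b, hFi a ha b hb, le_rfl⟩, inf_le_left.trans hax, inf_le_right.trans hby⟩
    · rintro x y hxy ⟨a, ha, hax⟩
      exact ⟨a, ha, hax.trans hxy⟩
  have hII : Order.IsIdeal {x | ∃ a ∈ I, x ≤ a} := by
    refine ⟨?_, ?_, ?_⟩
    · rintro x y hxy ⟨a, ha, hax⟩
      exact ⟨a, ha, hxy.trans hax⟩
    · obtain ⟨a, ha⟩ := hI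
      exact ⟨a, a, ha, le_rfl⟩
    · rintro x ⟨a, ha, hax⟩ y ⟨b, hb, hby⟩
      exact ⟨a ⊔ b, ⟨a ⊔ b, hIs a ha b hb, le_rfl⟩, hax.trans le_sup_left, hby.trans le_sup_right⟩
  obtain ⟨J, hJ, hIJ, hFJ⟩ := DistribLattice.prime_ideal_of_disjoint_filter_ideal
    (F := hFF.toPFilter) (I := hII.toIdeal) (by
      rw [Set.disjoint_left]
      rintro x ⟨a, ha, hax⟩ ⟨b, hb, hxb⟩
      exact hFI a ha b hb (hax.trans hxb))
  have htop : ⊤ ∉ J := fun h => hJ.toIsProper.ne_univ (by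
    ext x
    simpa using J.lower le_top h)
  refine ⟨{ toFun := fun x => decide (x ∉ J)
            map_sup' := fun x y => ?_
            map_inf' := fun x y => ?_
            map_top' := by simpa using htop
            map_bot' := by simp }, ?_, ?_⟩
  · simp [Order.Ideal.sup_mem_iff]
  · have : x ⊓ y ∈ J ↔ x ∈ J ∨ y ∈ J :=
      ⟨hJ.mem_or_mem, fun h => h.elim (J.lower inf_le_left) (J.lower inf_le_right)⟩
    simp [this]
  · intro a ha
    have : a ∉ J := Set.disjoint_left.1 hFJ ⟨a, ha, le_rfl⟩
    simpa using this
  · intro b hb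
    have : b ∈ J := hIJ ⟨b, hb, le_rfl⟩
    simpa using this

theorem exists_boolHom_of_not_le {α : Type*} [DistribLattice α] [BoundedOrder α] {x y : α}
    (h : ¬ x ≤ y) : ∃ φ : BoundedLatticeHom α Bool, φ x = true ∧ φ y = false := by
  obtain ⟨φ, h1, h2⟩ := exists_boolHom_of_sets {x} {y} ⟨x, rfl⟩ (by simp) ⟨y, rfl⟩ (by simp)
    (by simpa using h)
  exact ⟨φ, h1 x rfl, h2 y rfl⟩

theorem eq_of_forall_boolHom {α : Type*} [DistribLattice α] [BoundedOrder α] {x y : α}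
    (h : ∀ φ : BoundedLatticeHom α Bool, φ x = φ y) : x = y := by
  by_contra hne
  rcases not_and_or.1 (fun hh : x ≤ y ∧ y ≤ x => hne (le_antisymm hh.1 hh.2)) with h' | h' <;>
  · obtain ⟨φ, h1, h2⟩ := exists_boolHom_of_not_le h'
    simp_all

/-- Injectivity of the two-element lattice. An injective lattice homomorphism reflects order, so the
images of the prime filter and the prime ideal of `φ` can still be separated in `β`. Every extension
of homomorphisms to the simple algebras rests on this. -/
theorem exists_boolHom_extension {α β : Type*} [DistribLattice α] [BoundedOrder α]
    [DistribLattice β] [BoundedOrder β] (f : BoundedLatticeHom α β) (hf : Function.Injective f)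
    (φ : BoundedLatticeHom α Bool) : ∃ ψ : BoundedLatticeHom β Bool, ∀ x, ψ (f x) = φ x := by
  obtain ⟨ψ, h1, h2⟩ := exists_boolHom_of_sets (f '' {x | φ x = true}) (f '' {x | φ x = false})
    ⟨f ⊤, ⊤, by simp, rfl⟩
    (by
      rintro _ ⟨a, ha, rfl⟩ _ ⟨b, hb, rfl⟩
      exact ⟨a ⊓ b, by simp_all, by simp⟩)
    ⟨f ⊥, ⊥, by simp, rfl⟩
    (by
      rintro _ ⟨a, ha, rfl⟩ _ ⟨b, hb, rfl⟩
      exact ⟨a ⊔ b, by simp_all, by simp⟩)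
    (by
      rintro _ ⟨a, ha, rfl⟩ _ ⟨b, hb, rfl⟩ hab
      have h : a ⊓ b = a := hf (by simpa using hab)
      have h' : φ a ⊓ φ b = φ a := by rw [← map_inf, h]
      simp_all)
  refine ⟨ψ, fun x => ?_⟩
  rcases hx : φ x with _ | _
  · exact h2 _ ⟨x, hx, rfl⟩
  · exact h1 _ ⟨x, hx, rfl⟩

/-! ### Homomorphisms -/

section Hom

variable {A : Alg.{u}} {B : Alg.{v}}

theorem Hom.map_sup (f : Hom A B) (x y : A) : f (x ⊔ y) = f x ⊔ f y := f.map_sup' x y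
theorem Hom.map_inf (f : Hom A B) (x y : A) : f (x ⊓ y) = f x ⊓ f y := f.map_inf' x y
theorem Hom.map_top (f : Hom A B) : f ⊤ = ⊤ := f.map_top'
theorem Hom.map_bot (f : Hom A B) : f ⊥ = ⊥ := f.map_bot'
theorem Hom.map_star (f : Hom A B) (x : A) : f (A.star x) = B.star (f x) := f.map_star' x
theorem Hom.map_prime (f : Hom A B) (x : A) : f (A.prime x) = B.prime (f x) := f.map_prime' x

/-- A homomorphism from a function preserving all the operations. -/
def Hom.of (f : A → B) (sup : ∀ x y, f (x ⊔ y) = f x ⊔ f y) (inf : ∀ x y, f (x ⊓ y) = f x ⊓ f y)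
    (top : f ⊤ = ⊤) (bot : f ⊥ = ⊥) (star : ∀ x, f (A.star x) = B.star (f x))
    (prime : ∀ x, f (A.prime x) = B.prime (f x)) : Hom A B where
  toFun := f
  map_sup' := sup
  map_inf' := inf
  map_top' := top
  map_bot' := bot
  map_star' := star
  map_prime' := prime

/-- Composition of homomorphisms. -/
def Hom.comp {C : Alg} (g : Hom B C) (f : Hom A B) : Hom A C :=
  Hom.of (fun x => g (f x)) (fun x y => by rw [f.map_sup, g.map_sup])
    (fun x y => by rw [f.map_inf, g.map_inf]) (by rw [f.map_top, g.map_top])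
    (by rw [f.map_bot, g.map_bot]) (fun x => by rw [f.map_star, g.map_star])
    (fun x => by rw [f.map_prime, g.map_prime])

theorem Hom.exists_inverse (f : Hom A B) (hf : Function.Bijective f) :
    ∃ g : Hom B A, (∀ x, g (f x) = x) ∧ ∀ y, f (g y) = y := by
  let e := Equiv.ofBijective f hf
  have h1 : ∀ y, f (e.symm y) = y := e.apply_symm_apply
  have h2 : ∀ x, e.symm (f x) = x := e.symm_apply_apply
  refine ⟨Hom.of e.symm ?_ ?_ ?_ ?_ ?_ ?_, h2, h1⟩
  · exact fun x y => hf.1 (by rw [f.map_sup, h1, h1, h1])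
  · exact fun x y => hf.1 (by rw [f.map_inf, h1, h1, h1])
  · exact hf.1 (by rw [f.map_top, h1])
  · exact hf.1 (by rw [f.map_bot, h1])
  · exact fun x => hf.1 (by rw [f.map_star, h1, h1])
  · exact fun x => hf.1 (by rw [f.map_prime, h1, h1])

end Hom

/-! ### Powers, and separation by homomorphisms into one algebra -/

/-- A power of an algebra. -/
def Alg.power (S : Alg.{v}) (ι : Type u) : Alg.{max u v} where
  carrier := ι → S
  star x := fun i => S.star (x i)
  prime x := fun i => S.prime (x i)

/-- The isomorphic copy of a small algebra in a higher universe. -/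
def Alg.lift (S : Alg.{0}) : Alg.{u} := S.power PUnit.{u + 1}

/-- The coordinate projections. -/
def Hom.proj (S : Alg.{v}) {ι : Type u} (i : ι) : Hom (S.power ι) S :=
  Hom.of (fun x => x i) (fun _ _ => rfl) (fun _ _ => rfl) rfl rfl (fun _ => rfl) (fun _ => rfl)

/-- The homomorphism into a power induced by a family of homomorphisms. -/
def Hom.toPower {A : Alg.{w}} {S : Alg.{v}} {ι : Type u} (h : ι → Hom A S) : Hom A (S.power ι) :=
  Hom.of (fun x i => h i x) (fun _ _ => funext fun _ => Hom.map_sup _ _ _)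
    (fun _ _ => funext fun _ => Hom.map_inf _ _ _) (funext fun _ => Hom.map_top _)
    (funext fun _ => Hom.map_bot _) (fun _ => funext fun _ => Hom.map_star _ _)
    (fun _ => funext fun _ => Hom.map_prime _ _)

/-- The isomorphism from `S.lift` to `S`. -/
def Hom.down (S : Alg.{0}) : Hom (Alg.lift.{u} S) S := Hom.proj S PUnit.unit

/-- Maps into `S` lift to maps into `S.lift`. -/
def Hom.up {A : Alg.{v}} {S : Alg.{0}} (h : Hom A S) : Hom A (Alg.lift.{u} S) :=
  Hom.toPower fun _ => h

theorem Hom.down_bijective (S : Alg.{0}) : Function.Bijective (Hom.down.{u} S) :=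
  ⟨fun _ _ h => funext fun _ => h, fun s => ⟨fun _ => s, rfl⟩⟩

/-- Homomorphisms from `A` to `S` separate the points of `A`. -/
def Separated (A : Alg.{u}) (S : Alg.{0}) : Prop :=
  ∀ x y : A, (∀ h : Hom A S, h x = h y) → x = y

theorem Separated.le {A : Alg.{u}} {S : Alg.{0}} (hA : Separated A S) {x y : A}
    (h : ∀ h : Hom A S, h x ≤ h y) : x ≤ y := by
  rw [← inf_eq_left]
  refine hA _ _ fun f => ?_
  rw [f.map_inf, inf_eq_left]
  exact h f

theorem separated_power (S : Alg.{0}) (ι : Type u) : Separated (S.power ι) S :=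
  fun _ _ h => funext fun i => h (Hom.proj S i)

theorem IsVariety.mem_of_separated {V : Set Alg.{u}} (hV : IsVariety V) {S : Alg.{0}}
    (hS : S.lift ∈ V) {A : Alg.{u}} (hA : Separated A S) : A ∈ V := by
  refine hV.sub_mem A (Alg.pi fun _ : Hom A S => S.lift)
    (Hom.of (fun x h => h.up x) ?_ ?_ ?_ ?_ ?_ ?_) ?_ (hV.pi_mem _ _ fun _ => hS)
  · exact fun _ _ => funext fun _ => Hom.map_sup _ _ _
  · exact fun _ _ => funext fun _ => Hom.map_inf _ _ _
  · exact funext fun _ => Hom.map_top _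
  · exact funext fun _ => Hom.map_bot _
  · exact fun _ => funext fun _ => Hom.map_star _ _
  · exact fun _ => funext fun _ => Hom.map_prime _ _
  · exact fun x y hxy => hA x y fun h => congrFun (congrFun hxy h) PUnit.unit

/-- If a class consists of the algebras separated by homomorphisms to `S`, and `S` is injective in
it, then the class has the transferability property. -/
theorem hasTP_of_separated {K : Set Alg.{u}} {S : Alg.{0}} (hK : ∀ A, A ∈ K ↔ Separated A S)
    (hS : ∀ A ∈ K, ∀ B ∈ K, ∀ f : Hom A B, Function.Injective f → ∀ h : Hom A S,
      ∃ k : Hom B S, ∀ x, k (f x) = h x) : HasTP K := by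
  intro A hA B hB C hC f hf g
  -- Each composite `h ∘ g` on `A` extends to `B`. Together these extensions form the map from `B`
  -- to the power, while `C` embeds by evaluation.
  choose k hk using fun h : Hom C S => hS A hA B hB f hf (h.comp g)
  refine ⟨S.power (Hom C S), (hK _).2 (separated_power S _), Hom.toPower k,
    Hom.toPower fun h => h, fun x y hxy => (hK C).1 hC x y fun h => congrFun hxy h, fun x => ?_⟩
  exact funext fun h => hk h x

/-! ### The four simple algebras -/

/-- The two-element Boolean algebra. -/
def two : Alg.{0} where
  carrier := Bool
  star x := !x
  prime x := !x

/-- The three-element regular double Stone algebra. -/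
def threeDS : Alg.{0} where
  carrier := Fin 3
  lattice := instDistribLatticeOfLinearOrder
  star x := if x = 0 then 2 else 0
  prime x := if x = 2 then 0 else 2

/-- The three-element regular Kleene Stone algebra. -/
def threeKS : Alg.{0} where
  carrier := Fin 3
  lattice := instDistribLatticeOfLinearOrder
  star x := if x = 0 then 2 else 0
  prime x := Fin.rev x

instance : Fintype two := inferInstanceAs (Fintype Bool)
instance : DecidableEq two := inferInstanceAs (DecidableEq Bool)
instance : DecidableLE two := inferInstanceAs (DecidableLE Bool)
instance : Fintype threeDS := inferInstanceAs (Fintype (Fin 3))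
instance : DecidableEq threeDS := inferInstanceAs (DecidableEq (Fin 3))
instance : DecidableLE threeDS := inferInstanceAs (DecidableLE (Fin 3))
instance : Fintype threeKS := inferInstanceAs (Fintype (Fin 3))
instance : DecidableEq threeKS := inferInstanceAs (DecidableEq (Fin 3))
instance : DecidableLE threeKS := inferInstanceAs (DecidableLE (Fin 3))
instance : Fintype fourDMBA := inferInstanceAs (Fintype (Bool × Bool))
instance : DecidableEq fourDMBA := inferInstanceAs (DecidableEq (Bool × Bool))

/-! ### Identities are inherited by separated algebras -/

section Separated

variable {A : Alg.{u}} {S : Alg.{0}}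

theorem IsStone.of_separated (hS : IsStone S) (hA : Separated A S) : IsStone A where
  star_bot := hA _ _ fun h => by simp only [h.map_star, h.map_top, h.map_bot, hS.star_bot]
  star_top := hA _ _ fun h => by simp only [h.map_star, h.map_top, h.map_bot, hS.star_top]
  star_sup x y := hA _ _ fun h => by simp only [h.map_star, h.map_sup, h.map_inf, hS.star_sup]
  star_star_inf x y := hA _ _ fun h => by simp only [h.map_star, h.map_inf, hS.star_star_inf]
  le_star_star x := hA.le fun h => by simp only [h.map_star]; exact hS.le_star_star _
  star_inf_star_star x := hA _ _ fun h => by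
    simp only [h.map_star, h.map_inf, h.map_bot, hS.star_inf_star_star]
  star_sup_star_star x := hA _ _ fun h => by
    simp only [h.map_star, h.map_sup, h.map_top, hS.star_sup_star_star]

theorem IsDualStone.of_separated (hS : IsDualStone S) (hA : Separated A S) : IsDualStone A where
  prime_top := hA _ _ fun h => by simp only [h.map_prime, h.map_top, h.map_bot, hS.prime_top]
  prime_bot := hA _ _ fun h => by simp only [h.map_prime, h.map_top, h.map_bot, hS.prime_bot]
  prime_inf x y := hA _ _ fun h => by simp only [h.map_prime, h.map_sup, h.map_inf, hS.prime_inf]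
  prime_prime_sup x y := hA _ _ fun h => by
    simp only [h.map_prime, h.map_sup, hS.prime_prime_sup]
  prime_prime_le x := hA.le fun h => by simp only [h.map_prime]; exact hS.prime_prime_le _
  prime_sup_prime_prime x := hA _ _ fun h => by
    simp only [h.map_prime, h.map_sup, h.map_top, hS.prime_sup_prime_prime]
  prime_inf_prime_prime x := hA _ _ fun h => by
    simp only [h.map_prime, h.map_inf, h.map_bot, hS.prime_inf_prime_prime]

theorem IsKleene.of_separated (hS : IsKleene S) (hA : Separated A S) : IsKleene A where
  prime_top := hA _ _ fun h => by simp only [h.map_prime, h.map_top, h.map_bot, hS.prime_top]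
  prime_bot := hA _ _ fun h => by simp only [h.map_prime, h.map_top, h.map_bot, hS.prime_bot]
  prime_inf x y := hA _ _ fun h => by simp only [h.map_prime, h.map_sup, h.map_inf, hS.prime_inf]
  prime_prime x := hA _ _ fun h => by simp only [h.map_prime, hS.prime_prime]
  kleene x y := hA.le fun h => by
    simp only [h.map_prime, h.map_inf, h.map_sup]; exact hS.kleene _ _

theorem IsRegular.of_separated (hS : IsRegular S) (hA : Separated A S) : IsRegular A :=
  fun x y => hA.le fun h => by
    simp only [h.map_prime, h.map_star, h.map_inf, h.map_sup]; exact hS _ _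

end Separated

/-! ### Basic consequences of the identities -/

namespace IsStone

variable {A : Alg.{u}} (hA : IsStone A)
include hA

theorem star_anti {x y : A} (h : x ≤ y) : A.star y ≤ A.star x := by
  rw [← sup_eq_right.2 h, hA.star_sup]
  exact inf_le_left

theorem star_star_star (x : A) : A.star (A.star (A.star x)) = A.star x :=
  le_antisymm (hA.star_anti (hA.le_star_star x)) (hA.le_star_star _)

theorem inf_star (x : A) : x ⊓ A.star x = ⊥ :=
  le_bot_iff.1 <| (inf_le_inf_right _ (hA.le_star_star x)).trans
    (by rw [inf_comm, hA.star_inf_star_star])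

theorem isCompl_star (x : A) : IsCompl (A.star x) (A.star (A.star x)) :=
  IsCompl.of_eq (hA.star_inf_star_star x) (hA.star_sup_star_star x)

theorem star_inf (x y : A) : A.star (x ⊓ y) = A.star x ⊔ A.star y := by
  -- Both sides are complements of `x** ∧ y**`, and complements are unique in a distributive
  -- lattice.
  have h1 := hA.isCompl_star (x ⊓ y)
  rw [hA.star_star_inf] at h1
  refine h1.symm.right_unique (IsCompl.of_eq ?_ ?_)
  · rw [inf_sup_left, inf_right_comm, inf_comm _ (A.star x), hA.star_inf_star_star, bot_inf_eq,
      inf_assoc, inf_comm _ (A.star y), hA.star_inf_star_star, inf_bot_eq, bot_sup_eq]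
  · rw [sup_comm, sup_inf_left, sup_right_comm, hA.star_sup_star_star, top_sup_eq, sup_assoc,
      hA.star_sup_star_star, sup_top_eq, inf_top_eq]

theorem le_star_iff {x y : A} : x ≤ A.star y ↔ x ⊓ y = ⊥ := by
  constructor
  · intro h
    exact le_bot_iff.1 ((inf_le_inf_right _ h).trans (by rw [inf_comm, hA.inf_star]))
  · intro h
    have : A.star x ⊔ A.star y = ⊤ := by rw [← hA.star_inf, h, hA.star_bot]
    calc x = x ⊓ (A.star x ⊔ A.star y) := by rw [this, inf_top_eq]
      _ = x ⊓ A.star y := by rw [inf_sup_left, hA.inf_star, bot_sup_eq]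
      _ ≤ A.star y := inf_le_right

/-- Complemented elements have `*` as complement. -/
theorem star_eq_of_isCompl {x y : A} (h : IsCompl x y) : A.star x = y := by
  apply le_antisymm
  · rw [← inf_top_eq (A.star x), ← h.sup_eq_top, inf_sup_left, inf_comm, hA.inf_star, bot_sup_eq]
    exact inf_le_right
  · rw [hA.le_star_iff, inf_comm, h.inf_eq_bot]

/-- The value of `x*` under a lattice homomorphism to `Bool` bounds that of `x`. -/
theorem boolHom_le (φ : BoundedLatticeHom A Bool) (x : A) : φ x ≤ !φ (A.star x) := by
  have h : φ x ⊓ φ (A.star x) = ⊥ := by rw [← map_inf, hA.inf_star, map_bot]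
  revert h
  generalize φ x = a; generalize φ (A.star x) = b
  revert a b; decide

theorem boolHom_star_star (φ : BoundedLatticeHom A Bool) (x : A) :
    φ (A.star (A.star x)) = !φ (A.star x) := by
  have h1 : φ (A.star x) ⊓ φ (A.star (A.star x)) = ⊥ := by
    rw [← map_inf, hA.star_inf_star_star, map_bot]
  have h2 : φ (A.star x) ⊔ φ (A.star (A.star x)) = ⊤ := by
    rw [← map_sup, hA.star_sup_star_star, map_top]
  revert h1 h2
  generalize φ (A.star x) = a; generalize φ (A.star (A.star x)) = b
  revert a b; decide

end IsStone

/-! ### Boolean algebras -/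

theorem exists_hom_two {A : Alg.{u}} (hA : A ∈ BA) (φ : BoundedLatticeHom A Bool) :
    ∃ h : Hom A two, ∀ x, h x = φ x := by
  have hs : ∀ x, φ (A.star x) = !φ x := fun x => by
    have h1 : φ x ⊓ φ (A.star x) = ⊥ := by rw [← map_inf, (hA x).1.inf_eq_bot, map_bot]
    have h2 : φ x ⊔ φ (A.star x) = ⊤ := by rw [← map_sup, (hA x).1.sup_eq_top, map_top]
    revert h1 h2
    generalize φ x = a; generalize φ (A.star x) = b
    revert a b; decide
  exact ⟨Hom.of φ φ.map_sup' φ.map_inf' φ.map_top' φ.map_bot' hs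
    fun x => by rw [(hA x).2]; exact hs x, fun _ => rfl⟩

theorem BA_iff_separated (A : Alg.{u}) : A ∈ BA ↔ Separated A two := by
  constructor
  · intro hA x y h
    refine eq_of_forall_boolHom fun φ => ?_
    obtain ⟨k, hk⟩ := exists_hom_two hA φ
    rw [← hk, ← hk, h]
  · intro hA x
    have h1 : ∀ x : two, x ⊓ two.star x = ⊥ := by decide
    have h2 : ∀ x : two, x ⊔ two.star x = ⊤ := by decide
    exact ⟨IsCompl.of_eq
      (hA _ _ fun h => by rw [h.map_inf, h.map_star, h.map_bot, h1])
      (hA _ _ fun h => by rw [h.map_sup, h.map_star, h.map_top, h2]),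
      hA _ _ fun h => by rw [h.map_star, h.map_prime]; rfl⟩

theorem hasTP_BA : HasTP BA.{u} := by
  refine hasTP_of_separated BA_iff_separated fun A hA B hB f hf h => ?_
  obtain ⟨φ, hφ⟩ := exists_boolHom_extension f.toBoundedLatticeHom hf h.toBoundedLatticeHom
  obtain ⟨k, hk⟩ := exists_hom_two hB φ
  exact ⟨k, fun x => (hk _).trans (hφ x)⟩

/-! ### Regular double Stone algebras -/

/-- The elements of the three-element chain as monotone pairs of Booleans. -/
def chainDS (p q : Bool) : threeDS :=
  if p then (2 : Fin 3) else if q then (1 : Fin 3) else (0 : Fin 3)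

/-- The bounded lattice homomorphism to `Bool` given by the filter `{⊤}`. -/
def topDS : BoundedLatticeHom threeDS Bool where
  toFun x := decide (x = ⊤)
  map_sup' := by decide
  map_inf' := by decide
  map_top' := by decide
  map_bot' := by decide

namespace RDBLSt

variable {A : Alg.{u}} (hA : A ∈ RDBLSt)
include hA

theorem boolHom_prime_prime (φ : BoundedLatticeHom A Bool) (x : A) :
    φ (A.prime (A.prime x)) = !φ (A.prime x) := by
  have h1 : φ (A.prime x) ⊓ φ (A.prime (A.prime x)) = ⊥ := by
    rw [← map_inf, hA.2.1.prime_inf_prime_prime, map_bot]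
  have h2 : φ (A.prime x) ⊔ φ (A.prime (A.prime x)) = ⊤ := by
    rw [← map_sup, hA.2.1.prime_sup_prime_prime, map_top]
  revert h1 h2
  generalize φ (A.prime x) = a; generalize φ (A.prime (A.prime x)) = b
  revert a b; decide

/-- `x*` is complemented with complement `x**`, and a dual pseudocomplement takes a complemented
element to its complement. The auxiliary facts `h3` and `h4` say that `'` is the dual
pseudocomplement. -/
theorem star_prime (x : A) : A.prime (A.star x) = A.star (A.star x) := by
  have h : IsCompl (A.star x) (A.star (A.star x)) := hA.1.isCompl_star x
  have h1 : A.prime (A.star x) ⊔ A.prime (A.star (A.star x)) = ⊤ := by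
    rw [← hA.2.1.prime_inf, h.inf_eq_bot, hA.2.1.prime_bot]
  have h3 : ∀ y : A, y ⊔ A.prime y = ⊤ := fun y =>
    top_le_iff.1 (by
      rw [← hA.2.1.prime_sup_prime_prime y, sup_comm]
      exact sup_le_sup_right (hA.2.1.prime_prime_le y) _)
  have h4 : ∀ y z : A, y ⊔ z = ⊤ → A.prime y ≤ z := fun y z hyz => by
    have : A.prime (A.prime y) ⊔ A.prime (A.prime z) = ⊤ := by
      rw [← hA.2.1.prime_prime_sup, hyz, hA.2.1.prime_top, hA.2.1.prime_bot]
    calc A.prime y = A.prime y ⊓ (A.prime (A.prime y) ⊔ A.prime (A.prime z)) := by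
          rw [this, inf_top_eq]
      _ = A.prime y ⊓ A.prime (A.prime z) := by
          rw [inf_sup_left, hA.2.1.prime_inf_prime_prime, bot_sup_eq]
      _ ≤ z := inf_le_right.trans (hA.2.1.prime_prime_le z)
  apply le_antisymm (h4 _ _ h.sup_eq_top)
  calc A.star (A.star x) = A.star (A.star x) ⊓ (A.star x ⊔ A.prime (A.star x)) := by
        rw [h3, inf_top_eq]
    _ = A.star (A.star x) ⊓ A.prime (A.star x) := by
        rw [inf_sup_left, inf_comm _ (A.star x), h.inf_eq_bot, bot_sup_eq]
    _ ≤ _ := inf_le_right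

theorem prime_star (x : A) : A.star (A.prime x) = A.prime (A.prime x) :=
  hA.1.star_eq_of_isCompl
    (IsCompl.of_eq (hA.2.1.prime_inf_prime_prime x) (hA.2.1.prime_sup_prime_prime x))

theorem prime_sup (x y : A) : A.prime (x ⊔ y) = A.prime x ⊓ A.prime y := by
  refine eq_of_forall_boolHom fun φ => ?_
  have h : φ (A.prime (A.prime (x ⊔ y))) = φ (A.prime (A.prime x)) ⊔ φ (A.prime (A.prime y)) := by
    rw [← map_sup, hA.2.1.prime_prime_sup]
  rw [boolHom_prime_prime hA, boolHom_prime_prime hA, boolHom_prime_prime hA] at h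
  rw [map_inf]
  revert h
  generalize φ (A.prime (x ⊔ y)) = a; generalize φ (A.prime x) = b; generalize φ (A.prime y) = c
  revert a b c; decide

theorem boolHom_prime_of_star (φ : BoundedLatticeHom A Bool) (x : A)
    (h : φ (A.star x) = true) : φ (A.prime x) = true := by
  have h1 : φ (A.prime (A.prime x)) ≤ φ x := OrderHomClass.mono φ (hA.2.1.prime_prime_le x)
  have h2 := h1.trans (hA.1.boolHom_le φ x)
  rw [boolHom_prime_prime hA, h] at h2
  revert h2
  cases φ (A.prime x) <;> simp

/-- The two Booleans are the values of `φ` at `x''` and `x**`, because `x'` and `x*` are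
complemented. From `x'' ≤ x ≤ x**` the pair is monotone, so it names an element of the chain. -/
theorem exists_hom (φ : BoundedLatticeHom A Bool) :
    ∃ h : Hom A threeDS, ∀ x, h x = chainDS (!φ (A.prime x)) (!φ (A.star x)) := by
  have key := boolHom_prime_of_star hA φ
  refine ⟨Hom.of (fun x => chainDS (!φ (A.prime x)) (!φ (A.star x))) ?_ ?_ ?_ ?_ ?_ ?_,
    fun _ => rfl⟩
  · intro x y
    have h1 := key x
    have h2 := key y
    simp only [hA.1.star_sup, prime_sup hA, map_inf]
    revert h1 h2
    generalize φ (A.prime x) = a; generalize φ (A.star x) = b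
    generalize φ (A.prime y) = c; generalize φ (A.star y) = d
    revert a b c d; decide
  · intro x y
    have h1 := key x
    have h2 := key y
    simp only [hA.1.star_inf, hA.2.1.prime_inf, map_sup]
    revert h1 h2
    generalize φ (A.prime x) = a; generalize φ (A.star x) = b
    generalize φ (A.prime y) = c; generalize φ (A.star y) = d
    revert a b c d; decide
  · simp only [hA.2.1.prime_top, hA.1.star_top, map_bot]; rfl
  · simp only [hA.2.1.prime_bot, hA.1.star_bot, map_top]; rfl
  · intro x
    have h1 := key x
    simp only [star_prime hA, hA.1.boolHom_star_star]
    revert h1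
    generalize φ (A.prime x) = a; generalize φ (A.star x) = b
    revert a b; decide
  · intro x
    have h1 := key x
    simp only [prime_star hA, boolHom_prime_prime hA]
    revert h1
    generalize φ (A.prime x) = a; generalize φ (A.star x) = b
    revert a b; decide

/-- Regularity enters here. In `x = (x ∧ x') ∨ (x ∧ x'')` the first part lies below `y ∨ y*` by
regularity and the second below `y'' ≤ y`. Meeting with `x` then removes `y* = x*`. -/
theorem le_of_eq {x y : A} (h1 : A.prime x = A.prime y) (h2 : A.star x = A.star y) : x ≤ y := by
  have h : x ≤ y ⊔ A.star y :=
    calc x = x ⊓ (A.prime x ⊔ A.prime (A.prime x)) := by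
          rw [hA.2.1.prime_sup_prime_prime, inf_top_eq]
      _ = (x ⊓ A.prime x) ⊔ (x ⊓ A.prime (A.prime x)) := inf_sup_left _ _ _
      _ ≤ y ⊔ A.star y := sup_le (hA.2.2 x y) (by
          rw [h1]
          exact inf_le_right.trans ((hA.2.1.prime_prime_le y).trans le_sup_left))
  calc x = x ⊓ (y ⊔ A.star y) := (inf_eq_left.2 h).symm
    _ = x ⊓ y := by rw [inf_sup_left, ← h2, hA.1.inf_star, sup_bot_eq]
    _ ≤ y := inf_le_right

theorem separated : Separated A threeDS := by
  intro x y h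
  have h1 : ∀ φ : BoundedLatticeHom A Bool,
      φ (A.prime x) = φ (A.prime y) ∧ φ (A.star x) = φ (A.star y) := fun φ => by
    obtain ⟨k, hk⟩ := exists_hom hA φ
    have h2 := h k
    have kx := boolHom_prime_of_star hA φ x
    have ky := boolHom_prime_of_star hA φ y
    rw [hk, hk] at h2
    revert h2 kx ky
    generalize φ (A.prime x) = a; generalize φ (A.star x) = b
    generalize φ (A.prime y) = c; generalize φ (A.star y) = d
    revert a b c d; decide
  have h2 := eq_of_forall_boolHom fun φ => (h1 φ).1
  have h3 := eq_of_forall_boolHom fun φ => (h1 φ).2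
  exact le_antisymm (le_of_eq hA h2 h3) (le_of_eq hA h2.symm h3.symm)

end RDBLSt

theorem RDBLSt_iff_separated (A : Alg.{u}) : A ∈ RDBLSt ↔ Separated A threeDS := by
  refine ⟨fun hA => RDBLSt.separated hA, fun hA => ⟨?_, ?_, ?_⟩⟩
  · exact IsStone.of_separated (by constructor <;> decide) hA
  · exact IsDualStone.of_separated (by constructor <;> decide) hA
  · have h1 : ∀ x y : threeDS, x ⊓ threeDS.prime x ≤ y ⊔ threeDS.star y := by decide
    exact fun x y => hA.le fun h => by
      simp only [h.map_inf, h.map_sup, h.map_star, h.map_prime]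
      exact h1 _ _

/-- The extension built from `φ` only sees whether `h x'` and `h x*` equal the top, and in the
three-element chain this already determines `h x`. -/
theorem hasTP_RDBLSt : HasTP RDBLSt.{u} := by
  refine hasTP_of_separated RDBLSt_iff_separated fun A hA B hB f hf h => ?_
  obtain ⟨φ, hφ⟩ := exists_boolHom_extension f.toBoundedLatticeHom hf
    (topDS.comp h.toBoundedLatticeHom)
  obtain ⟨k, hk⟩ := RDBLSt.exists_hom hB φ
  refine ⟨k, fun x => ?_⟩
  have hφ' : ∀ x, φ (f x) = topDS (h x) := hφ
  rw [hk, ← f.map_prime, ← f.map_star, hφ', hφ', h.map_prime, h.map_star]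
  generalize h x = a
  revert a; decide

/-! ### Regular Kleene Stone algebras -/

/-- The elements of the three-element chain as monotone pairs of Booleans. -/
def chainKS (p q : Bool) : threeKS :=
  if p then (2 : Fin 3) else if q then (1 : Fin 3) else (0 : Fin 3)

/-- The bounded lattice homomorphism to `Bool` given by the filter `{⊤}`. -/
def topKS : BoundedLatticeHom threeKS Bool where
  toFun x := decide (x = ⊤)
  map_sup' := by decide
  map_inf' := by decide
  map_top' := by decide
  map_bot' := by decide

namespace RKLSt

variable {A : Alg.{u}} (hA : A ∈ RKLSt)
include hA

theorem prime_anti {x y : A} (h : x ≤ y) : A.prime y ≤ A.prime x := by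
  rw [← inf_eq_left.2 h, hA.2.1.prime_inf]
  exact le_sup_right

theorem prime_sup (x y : A) : A.prime (x ⊔ y) = A.prime x ⊓ A.prime y := by
  have h := hA.2.1.prime_inf (A.prime x) (A.prime y)
  rw [hA.2.1.prime_prime, hA.2.1.prime_prime] at h
  rw [← h, hA.2.1.prime_prime]

/-- The Kleene inequality forces `'` to be the complement on complemented elements: if `φ` agreed on
`x*` and its `'`, then `x*` and `x**` would violate the inequality in one of the two orders. -/
theorem star_prime (x : A) : A.prime (A.star x) = A.star (A.star x) := by
  have h : IsCompl (A.star x) (A.star (A.star x)) := hA.1.isCompl_star x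
  refine eq_of_forall_boolHom fun φ => ?_
  have h1 : φ (A.prime (A.star x)) ⊔ φ (A.prime (A.star (A.star x))) = ⊤ := by
    rw [← map_sup, ← hA.2.1.prime_inf, h.inf_eq_bot, hA.2.1.prime_bot, map_top]
  have h2 : φ (A.prime (A.star x)) ⊓ φ (A.prime (A.star (A.star x))) = ⊥ := by
    rw [← map_inf, ← prime_sup hA, h.sup_eq_top, hA.2.1.prime_top, map_bot]
  have h3 : ∀ y z : A, φ y ⊓ φ (A.prime y) ≤ φ z ⊔ φ (A.prime z) := fun y z => by
    rw [← map_inf, ← map_sup]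
    exact OrderHomClass.mono φ (hA.2.1.kleene y z)
  have h4 := h3 (A.star x) (A.star (A.star x))
  have h5 := h3 (A.star (A.star x)) (A.star x)
  rw [hA.1.boolHom_star_star] at h4 h5 ⊢
  revert h1 h2 h4 h5
  generalize φ (A.star x) = a; generalize φ (A.prime (A.star x)) = b
  generalize φ (A.prime (A.star (A.star x))) = c
  cases a <;> cases b <;> cases c <;> simp

theorem boolHom_prime_of_star (φ : BoundedLatticeHom A Bool) (x : A)
    (h : φ (A.star (A.prime x)) = true) : φ (A.star x) = false := by
  have h0 : A.star (A.prime x) ≤ x := by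
    rw [← hA.1.star_star_star, ← star_prime hA, ← hA.2.1.prime_prime x]
    rw [hA.2.1.prime_prime (A.prime x)]
    exact prime_anti hA (hA.1.le_star_star _)
  have h1 : φ (A.star (A.prime x)) ≤ φ x := OrderHomClass.mono φ h0
  have h2 := h1.trans (hA.1.boolHom_le φ x)
  rw [h] at h2
  revert h2
  cases φ (A.star x) <;> simp

/-- Now `x'*` is the complemented lower approximation of `x`, playing the part that `x''` has for
double Stone algebras: `x'* ≤ x ≤ x**`. -/
theorem exists_hom (φ : BoundedLatticeHom A Bool) :
    ∃ h : Hom A threeKS, ∀ x, h x = chainKS (φ (A.star (A.prime x))) (!φ (A.star x)) := by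
  have key := boolHom_prime_of_star hA φ
  refine ⟨Hom.of (fun x => chainKS (φ (A.star (A.prime x))) (!φ (A.star x))) ?_ ?_ ?_ ?_ ?_ ?_,
    fun _ => rfl⟩
  · intro x y
    have h1 := key x
    have h2 := key y
    simp only [hA.1.star_sup, hA.1.star_inf, prime_sup hA, map_inf, map_sup]
    revert h1 h2
    generalize φ (A.star (A.prime x)) = a; generalize φ (A.star x) = b
    generalize φ (A.star (A.prime y)) = c; generalize φ (A.star y) = d
    revert a b c d; decide
  · intro x y
    have h1 := key x
    have h2 := key y
    simp only [hA.1.star_inf, hA.2.1.prime_inf, hA.1.star_sup, map_inf, map_sup]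
    revert h1 h2
    generalize φ (A.star (A.prime x)) = a; generalize φ (A.star x) = b
    generalize φ (A.star (A.prime y)) = c; generalize φ (A.star y) = d
    revert a b c d; decide
  · simp only [hA.2.1.prime_top, hA.1.star_top, hA.1.star_bot, map_bot, map_top]; rfl
  · simp only [hA.2.1.prime_bot, hA.1.star_bot, hA.1.star_top, map_top, map_bot]; rfl
  · intro x
    have h1 := key x
    simp only [star_prime hA, hA.1.boolHom_star_star]
    revert h1
    generalize φ (A.star (A.prime x)) = a; generalize φ (A.star x) = b
    revert a b; decide
  · intro x
    have h1 := key x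
    simp only [hA.2.1.prime_prime]
    revert h1
    generalize φ (A.star (A.prime x)) = a; generalize φ (A.star x) = b
    revert a b; decide

theorem le_of_eq {x y : A} (h1 : A.star (A.prime x) = A.star (A.prime y))
    (h2 : A.star x = A.star y) : x ≤ y := by
  have h0 : A.star (A.prime y) ≤ y := by
    rw [← hA.1.star_star_star, ← star_prime hA]
    exact (prime_anti hA (hA.1.le_star_star _)).trans_eq (hA.2.1.prime_prime y)
  have h : x ≤ y ⊔ A.star y :=
    calc x = x ⊓ (A.star (A.prime x) ⊔ A.prime (A.star (A.prime x))) := by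
          rw [star_prime hA, hA.1.star_sup_star_star, inf_top_eq]
      _ = (x ⊓ A.star (A.prime x)) ⊔ (x ⊓ A.prime (A.star (A.prime x))) := inf_sup_left _ _ _
      _ ≤ y ⊔ A.star y := sup_le (by
          rw [h1]
          exact inf_le_right.trans (h0.trans le_sup_left)) (hA.2.2 x y)
  calc x = x ⊓ (y ⊔ A.star y) := (inf_eq_left.2 h).symm
    _ = x ⊓ y := by rw [inf_sup_left, ← h2, hA.1.inf_star, sup_bot_eq]
    _ ≤ y := inf_le_right

theorem separated : Separated A threeKS := by
  intro x y h
  have h1 : ∀ φ : BoundedLatticeHom A Bool,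
      φ (A.star (A.prime x)) = φ (A.star (A.prime y)) ∧ φ (A.star x) = φ (A.star y) := fun φ => by
    obtain ⟨k, hk⟩ := exists_hom hA φ
    have h2 := h k
    have kx := boolHom_prime_of_star hA φ x
    have ky := boolHom_prime_of_star hA φ y
    rw [hk, hk] at h2
    revert h2 kx ky
    generalize φ (A.star (A.prime x)) = a; generalize φ (A.star x) = b
    generalize φ (A.star (A.prime y)) = c; generalize φ (A.star y) = d
    revert a b c d; decide
  have h2 := eq_of_forall_boolHom fun φ => (h1 φ).1
  have h3 := eq_of_forall_boolHom fun φ => (h1 φ).2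
  exact le_antisymm (le_of_eq hA h2 h3) (le_of_eq hA h2.symm h3.symm)

end RKLSt

theorem RKLSt_iff_separated (A : Alg.{u}) : A ∈ RKLSt ↔ Separated A threeKS := by
  refine ⟨fun hA => RKLSt.separated hA, fun hA => ⟨?_, ?_, ?_⟩⟩
  · exact IsStone.of_separated (by constructor <;> decide) hA
  · exact IsKleene.of_separated (by constructor <;> decide) hA
  · exact IsRegular.of_separated (by unfold IsRegular; decide) hA

theorem hasTP_RKLSt : HasTP RKLSt.{u} := by
  refine hasTP_of_separated RKLSt_iff_separated fun A hA B hB f hf h => ?_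
  obtain ⟨φ, hφ⟩ := exists_boolHom_extension f.toBoundedLatticeHom hf
    (topKS.comp h.toBoundedLatticeHom)
  obtain ⟨k, hk⟩ := RKLSt.exists_hom hB φ
  refine ⟨k, fun x => ?_⟩
  have hφ' : ∀ x, φ (f x) = topKS (h x) := hφ
  rw [hk, ← f.map_prime, ← f.map_star, ← f.map_star, hφ', hφ', h.map_star, h.map_prime, h.map_star]
  generalize h x = a
  revert a; decide

/-! ### De Morgan Boolean algebras -/

/-- Identities of De Morgan Boolean algebras. -/
structure IsDeMorganBoolean (A : Alg.{u}) : Prop where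
  inf_star : ∀ x : A, x ⊓ A.star x = ⊥
  sup_star : ∀ x : A, x ⊔ A.star x = ⊤
  prime_bot : A.prime ⊥ = ⊤
  prime_top : A.prime ⊤ = ⊥
  prime_inf : ∀ x y : A, A.prime (x ⊓ y) = A.prime x ⊔ A.prime y
  prime_sup : ∀ x y : A, A.prime (x ⊔ y) = A.prime x ⊓ A.prime y
  prime_prime : ∀ x : A, A.prime (A.prime x) = x
  prime_star : ∀ x : A, A.prime (A.star x) = A.star (A.prime x)

theorem IsDeMorganBoolean.of_injective {A : Alg.{u}} {B : Alg.{v}} (f : Hom A B)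
    (hf : Function.Injective f) (hB : IsDeMorganBoolean B) : IsDeMorganBoolean A := by
  constructor
  · intro x; apply hf; rw [f.map_inf, f.map_star, f.map_bot, hB.inf_star]
  · intro x; apply hf; rw [f.map_sup, f.map_star, f.map_top, hB.sup_star]
  · apply hf; rw [f.map_prime, f.map_bot, f.map_top, hB.prime_bot]
  · apply hf; rw [f.map_prime, f.map_bot, f.map_top, hB.prime_top]
  · intro x y; apply hf; simp only [f.map_prime, f.map_inf, f.map_sup, hB.prime_inf]
  · intro x y; apply hf; simp only [f.map_prime, f.map_inf, f.map_sup, hB.prime_sup]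
  · intro x; apply hf; rw [f.map_prime, f.map_prime, hB.prime_prime]
  · intro x; apply hf; simp only [f.map_prime, f.map_star, hB.prime_star]

/-- Minimality of the generated variety transfers the identities to all members of `DMBA`. -/
theorem isVariety_isDeMorganBoolean : IsVariety {A : Alg.{u} | IsDeMorganBoolean A} where
  image_mem A B f hf hA := by
    constructor
    · rw [hf.forall]; intro x; rw [← f.map_star, ← f.map_inf, hA.inf_star, f.map_bot]
    · rw [hf.forall]; intro x; rw [← f.map_star, ← f.map_sup, hA.sup_star, f.map_top]
    · rw [← f.map_bot, ← f.map_prime, hA.prime_bot, f.map_top]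
    · rw [← f.map_top, ← f.map_prime, hA.prime_top, f.map_bot]
    · rw [hf.forall₂]; intro x y
      rw [← f.map_inf, ← f.map_prime, hA.prime_inf, f.map_sup, f.map_prime, f.map_prime]
    · rw [hf.forall₂]; intro x y
      rw [← f.map_sup, ← f.map_prime, hA.prime_sup, f.map_inf, f.map_prime, f.map_prime]
    · rw [hf.forall]; intro x; rw [← f.map_prime, ← f.map_prime, hA.prime_prime]
    · rw [hf.forall]; intro x
      rw [← f.map_star, ← f.map_prime, hA.prime_star, f.map_star, f.map_prime]
  sub_mem _ _ f hf hB := IsDeMorganBoolean.of_injective f hf hB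
  pi_mem ι A hA :=
    { inf_star := fun x => funext fun i => (hA i).inf_star (x i)
      sup_star := fun x => funext fun i => (hA i).sup_star (x i)
      prime_bot := funext fun i => (hA i).prime_bot
      prime_top := funext fun i => (hA i).prime_top
      prime_inf := fun x y => funext fun i => (hA i).prime_inf (x i) (y i)
      prime_sup := fun x y => funext fun i => (hA i).prime_sup (x i) (y i)
      prime_prime := fun x => funext fun i => (hA i).prime_prime (x i)
      prime_star := fun x => funext fun i => (hA i).prime_star (x i) }

theorem isDeMorganBoolean_fourDMBA : IsDeMorganBoolean fourDMBA := by
  constructor <;> decide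

theorem isDeMorganBoolean_of_mem {A : Alg.{u}} (hA : A ∈ DMBA) : IsDeMorganBoolean A :=
  hA _ isVariety_isDeMorganBoolean fun _ ⟨f, hf⟩ =>
    IsDeMorganBoolean.of_injective f hf.1 isDeMorganBoolean_fourDMBA

/-- The pairs of Booleans as elements of the four-element algebra. -/
def pairDM (p q : Bool) : fourDMBA := ((p, q) : Bool × Bool)

/-- A prime filter `P` has a companion `{x | x' ∉ P}`, which is again a prime filter. The operation
`'` swaps the two memberships and negates them. -/
theorem IsDeMorganBoolean.exists_hom {A : Alg.{u}} (hA : IsDeMorganBoolean A)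
    (φ : BoundedLatticeHom A Bool) :
    ∃ h : Hom A fourDMBA, ∀ x, h x = pairDM (φ x) (!φ (A.prime x)) := by
  have hs : ∀ x, φ (A.star x) = !φ x := fun x => by
    have h1 : φ x ⊓ φ (A.star x) = ⊥ := by rw [← map_inf, hA.inf_star, map_bot]
    have h2 : φ x ⊔ φ (A.star x) = ⊤ := by rw [← map_sup, hA.sup_star, map_top]
    revert h1 h2
    generalize φ x = a; generalize φ (A.star x) = b
    revert a b; decide
  refine ⟨Hom.of (fun x => pairDM (φ x) (!φ (A.prime x))) ?_ ?_ ?_ ?_ ?_ ?_,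
    fun _ => rfl⟩
  · intro x y
    simp only [hA.prime_sup, map_inf, map_sup]
    generalize φ (A.prime x) = a; generalize φ x = b
    generalize φ (A.prime y) = c; generalize φ y = d
    revert a b c d; decide
  · intro x y
    simp only [hA.prime_inf, map_inf, map_sup]
    generalize φ (A.prime x) = a; generalize φ x = b
    generalize φ (A.prime y) = c; generalize φ y = d
    revert a b c d; decide
  · simp only [hA.prime_top, map_bot, map_top]; rfl
  · simp only [hA.prime_bot, map_bot, map_top]; rfl
  · intro x
    simp only [hA.prime_star, hs]
    generalize φ (A.prime x) = a; generalize φ x = b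
    revert a b; decide
  · intro x
    simp only [hA.prime_prime]
    generalize φ (A.prime x) = a; generalize φ x = b
    revert a b; decide

theorem DMBA_iff_separated (A : Alg.{u}) : A ∈ DMBA ↔ Separated A fourDMBA := by
  constructor
  · intro hA x y h
    refine eq_of_forall_boolHom fun φ => ?_
    obtain ⟨k, hk⟩ := (isDeMorganBoolean_of_mem hA).exists_hom φ
    have h1 := h k
    rw [hk, hk] at h1
    exact congrArg Prod.fst h1
  · exact fun hA V hV hKV => hV.mem_of_separated (S := fourDMBA)
      (hKV ⟨Hom.down fourDMBA, Hom.down_bijective _⟩) hA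

/-- The first projection of the four-element algebra. -/
def fstDM : BoundedLatticeHom fourDMBA Bool where
  toFun x := Prod.fst (α := Bool) (β := Bool) x
  map_sup' _ _ := rfl
  map_inf' _ _ := rfl
  map_top' := rfl
  map_bot' := rfl

/-- The second coordinate of `h x` is the negated first coordinate of `h x'`, so extending the first
coordinate suffices. -/
theorem hasTP_DMBA : HasTP DMBA.{u} := by
  refine hasTP_of_separated DMBA_iff_separated fun A hA B hB f hf h => ?_
  obtain ⟨φ, hφ⟩ := exists_boolHom_extension f.toBoundedLatticeHom hf
    (fstDM.comp h.toBoundedLatticeHom)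
  obtain ⟨k, hk⟩ := (isDeMorganBoolean_of_mem hB).exists_hom φ
  refine ⟨k, fun x => ?_⟩
  have hφ' : ∀ x, φ (f x) = fstDM (h x) := hφ
  rw [hk, ← f.map_prime, hφ', hφ', h.map_prime]
  generalize h x = a
  revert a; decide

/-! ### Quotients -/

/-- Congruences of an algebra are kernels of surjective homomorphisms. -/
theorem exists_quotient (A : Alg.{u}) (r : Setoid A)
    (sup : ∀ {a b c d : A}, r a b → r c d → r (a ⊔ c) (b ⊔ d))
    (inf : ∀ {a b c d : A}, r a b → r c d → r (a ⊓ c) (b ⊓ d))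
    (star : ∀ {a b : A}, r a b → r (A.star a) (A.star b))
    (prime : ∀ {a b : A}, r a b → r (A.prime a) (A.prime b)) :
    ∃ (Q : Alg.{u}) (f : Hom A Q), Function.Surjective f ∧ ∀ x y, f x = f y ↔ r x y := by
  obtain ⟨T, q, hq, hr⟩ : ∃ (T : Type u) (q : A → T),
      Function.Surjective q ∧ ∀ a b, q a = q b ↔ r a b :=
    ⟨Quotient r, Quotient.mk r, Quotient.mk_surjective, fun _ _ => Quotient.eq⟩
  choose g hg using hq
  have hgr : ∀ a, r (g (q a)) a := fun a => (hr _ _).1 (hg (q a))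
  let _ : Max T := ⟨fun a b => q (g a ⊔ g b)⟩
  let _ : Min T := ⟨fun a b => q (g a ⊓ g b)⟩
  have hsup : ∀ a b : A, q a ⊔ q b = q (a ⊔ b) := fun a b => (hr _ _).2 (sup (hgr a) (hgr b))
  have hinf : ∀ a b : A, q a ⊓ q b = q (a ⊓ b) := fun a b => (hr _ _).2 (inf (hgr a) (hgr b))
  have hq : Function.Surjective q := fun t => ⟨g t, hg t⟩
  let _ : Lattice T := Lattice.mk'
    (hq.forall₂.2 fun a b => by rw [hsup, hsup, sup_comm])
    (hq.forall₃.2 fun a b c => by rw [hsup, hsup, hsup, hsup, sup_assoc])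
    (hq.forall₂.2 fun a b => by rw [hinf, hinf, inf_comm])
    (hq.forall₃.2 fun a b c => by rw [hinf, hinf, hinf, hinf, inf_assoc])
    (hq.forall₂.2 fun a b => by rw [hinf, hsup, sup_inf_self])
    (hq.forall₂.2 fun a b => by rw [hsup, hinf, inf_sup_self])
  let _ : DistribLattice T := DistribLattice.ofInfSupLe
    (hq.forall₃.2 fun a b c => by
      change q a ⊓ (q b ⊔ q c) ≤ q a ⊓ q b ⊔ q a ⊓ q c
      rw [hsup, hinf, hinf, hinf, hsup, inf_sup_left])
  let _ : BoundedOrder T :=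
    { top := q ⊤
      bot := q ⊥
      le_top := hq.forall.2 fun a => inf_eq_left.1 ((hinf _ _).trans (by rw [inf_top_eq]))
      bot_le := hq.forall.2 fun a => inf_eq_left.1 ((hinf _ _).trans (by rw [bot_inf_eq])) }
  let Q : Alg.{u} :=
    { carrier := T
      star := fun t => q (A.star (g t))
      prime := fun t => q (A.prime (g t)) }
  let f : Hom A Q := Hom.of q (fun a b => (hsup a b).symm) (fun a b => (hinf a b).symm) rfl rfl
    (fun a => ((hr _ _).2 (star (hgr a))).symm) (fun a => ((hr _ _).2 (prime (hgr a))).symm)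
  exact ⟨Q, f, hq, hr⟩

/-! ### The Boolean skeleton of an almost Gautama algebra -/

namespace AG

variable {A : Alg.{u}} (hA : A ∈ AG)
include hA

theorem prime_anti {x y : A} (h : x ≤ y) : A.prime y ≤ A.prime x := by
  rw [← inf_eq_left.2 h, hA.2.1.prime_inf]
  exact le_sup_right

omit hA in
/-- The elements on which `*` and `'` agree and are complements. -/
structure IsCentral (z : A) : Prop where
  sup_star : z ⊔ A.star z = ⊤
  prime_eq : A.prime z = A.star z

theorem IsCentral.star_star {z : A} (hz : IsCentral z) : A.star (A.star z) = z :=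
  hA.1.star_eq_of_isCompl (IsCompl.of_eq (by rw [inf_comm, hA.1.inf_star])
    (by rw [sup_comm, hz.sup_star]))

theorem IsCentral.star {z : A} (hz : IsCentral z) : IsCentral (A.star z) where
  sup_star := hA.1.star_sup_star_star z
  prime_eq := by
    have h := hA.2.2.2.1 (A.star z)
    rw [hz.star_star hA, hz.prime_eq] at h
    rw [hz.star_star hA, h]

theorem IsCentral.inf {z w : A} (hz : IsCentral z) (hw : IsCentral w) : IsCentral (z ⊓ w) where
  sup_star := by
    rw [hA.1.star_inf, sup_inf_right, ← sup_assoc, hz.sup_star, top_sup_eq, top_inf_eq,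
      sup_left_comm, hw.sup_star, sup_top_eq]
  prime_eq := by rw [hA.2.1.prime_inf, hA.1.star_inf, hz.prime_eq, hw.prime_eq]

theorem IsCentral.sup {z w : A} (hz : IsCentral z) (hw : IsCentral w) : IsCentral (z ⊔ w) := by
  have h := IsCentral.star hA ((hz.star hA).inf hA (hw.star hA))
  rwa [hA.1.star_inf, hz.star_star hA, hw.star_star hA] at h

theorem isCentral_top : IsCentral (⊤ : A) :=
  ⟨top_sup_eq _, by rw [hA.2.1.prime_top, hA.1.star_top]⟩

theorem isCentral_bot : IsCentral (⊥ : A) :=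
  ⟨by rw [hA.1.star_bot, sup_top_eq], by rw [hA.2.1.prime_bot, hA.1.star_bot]⟩

/-- By (L1) `y = y'*`, so `y** = y` and `y` is complemented, `y' ≤ y*`, and `x*'' = x*` gives `y'' =
y`. Applying `'` to `y ∧ y* = 0` gives `y' ∨ y*' = 1` with `y*' ≤ y'' = y`, hence `y' ∨ y = 1` and
`y* ≤ y'`. -/
theorem isCentral_box (x : A) : IsCentral (x ⊓ A.star (A.prime x)) := by
  set y := x ⊓ A.star (A.prime x) with hy
  have h1 : A.star (A.prime y) = y := hA.2.2.2.2 x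
  have h2 : A.star (A.star y) = y := by rw [← h1, hA.1.star_star_star]
  have h3 : y ⊔ A.star y = ⊤ := by
    have := hA.1.star_sup_star_star y
    rwa [h2, sup_comm] at this
  have h4 : A.prime y ≤ A.star y := by
    have := hA.1.le_star_star (A.prime y)
    rwa [h1] at this
  have h5 : A.prime (A.prime y) = y := by
    have := hA.2.2.2.1 (A.star y)
    rwa [h2] at this
  have h6 : A.prime y ⊔ y = ⊤ := by
    rw [← top_le_iff, ← hA.2.1.prime_bot, ← hA.1.inf_star y, hA.2.1.prime_inf]
    exact sup_le_sup_left ((prime_anti hA h4).trans_eq h5) _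
  refine ⟨h3, le_antisymm h4 ?_⟩
  calc A.star y = A.star y ⊓ (A.prime y ⊔ y) := by rw [h6, inf_top_eq]
    _ = A.star y ⊓ A.prime y := by rw [inf_sup_left, inf_comm _ y, hA.1.inf_star, sup_bot_eq]
    _ ≤ A.prime y := inf_le_right

theorem IsCentral.star_inf_inf {z : A} (_ : IsCentral z) (x : A) :
    A.star (x ⊓ z) ⊓ z = A.star x ⊓ z := by
  rw [hA.1.star_inf, inf_sup_right, inf_comm (A.star z), hA.1.inf_star, sup_bot_eq]

theorem IsCentral.prime_inf_inf {z : A} (hz : IsCentral z) (x : A) :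
    A.prime (x ⊓ z) ⊓ z = A.prime x ⊓ z := by
  rw [hA.2.1.prime_inf, hz.prime_eq, inf_sup_right, inf_comm (A.star z), hA.1.inf_star, sup_bot_eq]

omit hA in
theorem inf_eq_inf_of_le {x y z w : A} (h : x ⊓ z = y ⊓ z) (hw : w ≤ z) : x ⊓ w = y ⊓ w := by
  rw [← inf_eq_right.2 hw, ← inf_assoc, ← inf_assoc, h]

/-- Distinct elements remain distinct in a quotient in which the box operator
`x ∧ x'*` annihilates every element other than the top. -/
theorem exists_simple_quotient {x y : A} (hxy : x ≠ y) :
    ∃ (Q : Alg.{u}) (f : Hom A Q), Function.Surjective f ∧ f x ≠ f y ∧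
      ∀ q : Q, q ≠ ⊤ → q ⊓ Q.star (Q.prime q) = ⊥ := by
  -- The central elements below which `x` and `y` agree are closed under joins and omit the top, so
  -- some prime ideal contains them all.
  obtain ⟨φ, -, hφ⟩ := exists_boolHom_of_sets {(⊤ : A)} {z | IsCentral z ∧ x ⊓ z = y ⊓ z}
    ⟨⊤, rfl⟩ (by simp) ⟨⊥, isCentral_bot hA, by simp⟩
    (fun a ha b hb => ⟨ha.1.sup hA hb.1, by rw [inf_sup_left, inf_sup_left, ha.2, hb.2]⟩)
    (by
      rintro _ rfl b hb h
      obtain rfl : b = ⊤ := top_le_iff.1 h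
      exact hxy (by simpa using hb.2))
  -- Identify elements that agree below some central `z` in the prime filter of `φ`.
  let r : Setoid A :=
    { r := fun a b => ∃ z, IsCentral z ∧ φ z = true ∧ a ⊓ z = b ⊓ z
      iseqv :=
        { refl := fun a => ⟨⊤, isCentral_top hA, map_top φ, rfl⟩
          symm := fun ⟨z, h1, h2, h3⟩ => ⟨z, h1, h2, h3.symm⟩
          trans := fun ⟨z, h1, h2, h3⟩ ⟨w, k1, k2, k3⟩ => ⟨z ⊓ w, h1.inf hA k1,
            by rw [map_inf, h2, k2]; rfl,
            (inf_eq_inf_of_le h3 inf_le_left).trans (inf_eq_inf_of_le k3 inf_le_right)⟩ } }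
  obtain ⟨Q, f, hf, hfr⟩ := exists_quotient A r
    (fun ⟨z, h1, h2, h3⟩ ⟨w, k1, k2, k3⟩ => ⟨z ⊓ w, h1.inf hA k1, by rw [map_inf, h2, k2]; rfl,
      by rw [inf_sup_right, inf_sup_right, inf_eq_inf_of_le h3 inf_le_left,
        inf_eq_inf_of_le k3 inf_le_right]⟩)
    (fun ⟨z, h1, h2, h3⟩ ⟨w, k1, k2, k3⟩ => ⟨z ⊓ w, h1.inf hA k1, by rw [map_inf, h2, k2]; rfl,
      by rw [inf_inf_inf_comm, h3, k3, inf_inf_inf_comm]⟩)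
    (fun ⟨z, h1, h2, h3⟩ => ⟨z, h1, h2, by
      rw [← h1.star_inf_inf hA, h3, h1.star_inf_inf hA]⟩)
    (fun ⟨z, h1, h2, h3⟩ => ⟨z, h1, h2, by
      rw [← h1.prime_inf_inf hA, h3, h1.prime_inf_inf hA]⟩)
  refine ⟨Q, f, hf, fun h => ?_, fun q hq => ?_⟩
  · obtain ⟨z, h1, h2, h3⟩ := (hfr x y).1 h
    have := hφ z ⟨h1, h3⟩
    simp [h2] at this
  · obtain ⟨a, rfl⟩ := hf q
    have hb := isCentral_box hA a
    rw [← f.map_prime, ← f.map_star, ← f.map_inf, ← f.map_bot, hfr]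
    -- The prime filter contains the central element `a ∧ a'*` or its complement. The complement
    -- makes the box of `q` zero; otherwise `q` would be the top.
    refine ⟨_, hb.star hA, ?_, by rw [hA.1.inf_star, bot_inf_eq]⟩
    by_contra hn
    refine hq ?_
    rw [← f.map_top, hfr]
    refine ⟨_, hb, ?_, by rw [top_inf_eq, ← inf_assoc, inf_idem]⟩
    have h : φ (a ⊓ A.star (A.prime a)) ⊔ φ (A.star (a ⊓ A.star (A.prime a))) = ⊤ := by
      rw [← map_sup, hb.sup_star, map_top]
    simpa [Bool.eq_false_iff.2 hn] using h

/-! ### Classification of the simple algebras -/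

/-- An almost Gautama algebra with `x ∧ x'* = 0` for all `x ≠ 1` has at most four elements. -/
theorem classification (hs : ∀ x : A, x ≠ ⊤ → x ⊓ A.star (A.prime x) = ⊥) :
    (∀ x : A, x = ⊥ ∨ x = ⊤) ∨
    (∃ d : A, d ≠ ⊤ ∧ d ≠ ⊥ ∧ A.star d = ⊥ ∧ (A.prime d = ⊤ ∨ A.prime d = d) ∧
      ∀ x : A, x = ⊥ ∨ x = d ∨ x = ⊤) ∨
    (∃ c : A, c ≠ ⊤ ∧ c ≠ ⊥ ∧ IsCompl c (A.star c) ∧ A.prime c = c ∧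
      A.prime (A.star c) = A.star c ∧ ∀ x : A, x = ⊥ ∨ x = c ∨ x = A.star c ∨ x = ⊤) := by
  have hps : ∀ x : A, x ≠ ⊤ → A.star (A.prime x) ≤ A.star x := fun x hx => by
    rw [hA.1.le_star_iff, inf_comm, hs x hx]
  have hsk : ∀ x : A, A.prime (A.prime (A.star x)) = A.star x := hA.2.2.2.1
  -- Split on a dense element other than `1`: its presence yields a three-element chain, its absence
  -- a Boolean reduct.
  by_cases hd : ∃ d : A, d ≠ ⊤ ∧ A.star d = ⊥
  · obtain ⟨d, hd1, hd0⟩ := hd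
    have hle : ∀ x : A, x ≠ ⊤ → A.star x = ⊥ → ∀ y, x ≤ y ⊔ A.star y := fun x hx hx0 y => by
      have h1 := hA.2.2.1 x y
      have h2 : A.star (A.prime x) = ⊥ := le_bot_iff.1 ((hps x hx).trans_eq hx0)
      rwa [h2, hA.2.1.prime_bot, inf_top_eq] at h1
    -- By (R1) two dense elements other than `1` lie below each other. As `d'` is dense too, this
    -- leaves only `d` and `1` as its values.
    have huniq : ∀ y : A, A.star y = ⊥ → y = d ∨ y = ⊤ := fun y hy => by
      by_cases hyt : y = ⊤
      · exact Or.inr hyt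
      · have h1 := hle y hyt hy d
        have h2 := hle d hd1 hd0 y
        rw [hd0, sup_bot_eq] at h1
        rw [hy, sup_bot_eq] at h2
        exact Or.inl (le_antisymm h1 h2)
    have hd' : A.prime d = d ∨ A.prime d = ⊤ :=
      huniq _ (le_bot_iff.1 ((hps d hd1).trans_eq hd0))
    have hdense : ∀ y : A, d ≤ y → y = d ∨ y = ⊤ := fun y h =>
      huniq y (le_bot_iff.1 ((hA.1.star_anti h).trans_eq hd0))
    have hbelow : ∀ x : A, A.star x ≤ d → A.star x = ⊥ := fun x hx => by
      rcases hd' with h | h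
      · have h1 : d ≤ A.prime (A.star x) := h.symm.le.trans (prime_anti hA hx)
        rcases hdense _ h1 with h2 | h2
        · have h3 := hsk x
          rw [h2, h] at h3
          have h4 := hA.1.star_sup_star_star x
          rw [← h3, hd0, sup_bot_eq] at h4
          exact absurd h4 hd1
        · rw [← hsk x, h2, hA.2.1.prime_top]
      · have h1 : A.prime (A.star x) = ⊤ := top_le_iff.1 (h.symm.le.trans (prime_anti hA hx))
        rw [← hsk x, h1, hA.2.1.prime_top]
    have hor : ∀ x : A, d ⊔ A.star x = ⊤ → A.star (A.star x) = ⊥ := fun x h => by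
      refine hbelow _ ?_
      calc A.star (A.star x) = A.star (A.star x) ⊓ (d ⊔ A.star x) := by rw [h, inf_top_eq]
        _ = A.star (A.star x) ⊓ d := by
          rw [inf_sup_left, inf_comm _ (A.star x), hA.1.inf_star, sup_bot_eq]
        _ ≤ d := inf_le_right
    refine Or.inr (Or.inl ⟨d, hd1, ?_, hd0, hd'.symm, fun x => ?_⟩)
    · rintro rfl
      rw [hA.1.star_bot] at hd0
      exact hd1 hd0.symm
    · rcases hdense (d ⊔ A.star x) le_sup_left with h | h
      · exact Or.inr (huniq x (hbelow x (sup_eq_left.1 h)))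
      · exact Or.inl (le_bot_iff.1 ((hA.1.le_star_star x).trans_eq (hor x h)))
  · push Not at hd
    have hcompl : ∀ x : A, IsCompl x (A.star x) := fun x => by
      refine IsCompl.of_eq (hA.1.inf_star x) ?_
      by_contra h
      exact hd _ h (by rw [hA.1.star_sup, hA.1.star_inf_star_star])
    have hss : ∀ x : A, A.star (A.star x) = x := fun x =>
      hA.1.star_eq_of_isCompl (hcompl x).symm
    have hpp : ∀ x : A, A.prime (A.prime x) = x := fun x => by
      have := hsk (A.star x)
      rwa [hss] at this
    have hxp : ∀ x : A, x ≠ ⊤ → x ≤ A.prime x := fun x hx => by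
      have h := hs x hx
      rwa [← hA.1.le_star_iff, hss] at h
    -- Use `x ≤ x'` for both `x` and `x'`, since `'` is now an involution.
    have hp : ∀ x : A, x ≠ ⊤ → x ≠ ⊥ → A.prime x = x := fun x h1 h0 => by
      refine le_antisymm ?_ (hxp x h1)
      have h := hxp (A.prime x) fun h => h0 (by rw [← hpp x, h, hA.2.1.prime_top])
      rwa [hpp] at h
    by_cases hc : ∃ c : A, c ≠ ⊤ ∧ c ≠ ⊥
    · obtain ⟨c, hc1, hc0⟩ := hc
      -- The antitone map `'` fixes every element other than `0` and `1`, so these form an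
      -- antichain.
      have hanti : ∀ x y : A, x ≠ ⊥ → y ≠ ⊤ → x ≤ y → x = y := fun x y hx hy hxy => by
        have hx1 : x ≠ ⊤ := fun h => hy (top_le_iff.1 (h ▸ hxy))
        have hy0 : y ≠ ⊥ := fun h => hx (le_bot_iff.1 (h ▸ hxy))
        have h := prime_anti hA hxy
        rw [hp x hx1 hx, hp y hy hy0] at h
        exact le_antisymm hxy h
      have hs1 : A.star c ≠ ⊤ := fun h => hc0 (by rw [← hss c, h, hA.1.star_top])
      have hs0 : A.star c ≠ ⊥ := fun h => hc1 (by rw [← hss c, h, hA.1.star_bot])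
      refine Or.inr (Or.inr ⟨c, hc1, hc0, hcompl c, hp c hc1 hc0, hp _ hs1 hs0, fun x => ?_⟩)
      by_cases hx1 : x = ⊤
      · simp [hx1]
      by_cases hx0 : x = ⊥
      · simp [hx0]
      by_cases h : x ⊓ c = ⊥
      · exact Or.inr (Or.inr (Or.inl (hanti _ _ hx0 hs1 (hA.1.le_star_iff.2 h))))
      · exact Or.inr (Or.inl ((hanti _ _ h hx1 inf_le_left).symm.trans
          (hanti _ _ h hc1 inf_le_right)))
    · push Not at hc
      exact Or.inl fun x => or_iff_not_imp_right.2 (hc x)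

end AG

/-! ### Recognition of the four simple algebras -/

/-- The four simple almost Gautama algebras. -/
def IsBasic (S : Alg.{0}) : Prop := S = two ∨ S = threeDS ∨ S = threeKS ∨ S = fourDMBA

/-- A bounded algebra in which `*` and `'` exchange `⊥` and `⊤`. -/
structure HasBooleanBounds (A : Alg.{u}) : Prop where
  star_bot : A.star ⊥ = ⊤
  star_top : A.star ⊤ = ⊥
  prime_bot : A.prime ⊥ = ⊤
  prime_top : A.prime ⊤ = ⊥

theorem AG.hasBooleanBounds {A : Alg.{u}} (hA : A ∈ AG) : HasBooleanBounds A :=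
  ⟨hA.1.star_bot, hA.1.star_top, hA.2.1.prime_bot, hA.2.1.prime_top⟩

theorem IsBasic.hasBooleanBounds {S : Alg.{0}} (hS : IsBasic S) : HasBooleanBounds S := by
  rcases hS with rfl | rfl | rfl | rfl <;> constructor <;> decide

theorem IsBasic.bot_ne_top {S : Alg.{0}} (hS : IsBasic S) : (⊥ : S) ≠ ⊤ := by
  rcases hS with rfl | rfl | rfl | rfl <;> decide

theorem exists_hom_from_two {A : Alg.{u}} (hA : HasBooleanBounds A) :
    Nonempty (Hom two A) := by
  have h2 : ∀ x : two, x = ⊥ ∨ x = ⊤ := by decide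
  have hs : two.star ⊥ = ⊤ ∧ two.star ⊤ = ⊥ := by decide
  have hp : two.prime ⊥ = ⊤ ∧ two.prime ⊤ = ⊥ := by decide
  have hne : (⊤ : two) ≠ ⊥ := by decide
  refine ⟨Hom.of (fun x => if x = ⊥ then ⊥ else ⊤) ?_ ?_ ?_ ?_ ?_ ?_⟩
  · intro x y
    rcases h2 x with rfl | rfl <;> rcases h2 y with rfl | rfl <;> simp
  · intro x y
    rcases h2 x with rfl | rfl <;> rcases h2 y with rfl | rfl <;> simp [hne]
  · simp [hne]
  · simp
  · intro x
    rcases h2 x with rfl | rfl <;> simp [hne, hs, hA.star_bot, hA.star_top]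
  · intro x
    rcases h2 x with rfl | rfl <;> simp [hne, hp, hA.prime_bot, hA.prime_top]

theorem exists_injective_hom_from_two {A : Alg.{u}} (hA : HasBooleanBounds A)
    (hne : (⊥ : A) ≠ ⊤) : ∃ f : Hom two A, Function.Injective f := by
  obtain ⟨f⟩ := exists_hom_from_two hA
  have h2 : ∀ x : two, x = ⊥ ∨ x = ⊤ := by decide
  refine ⟨f, fun x y h => ?_⟩
  rcases h2 x with rfl | rfl <;> rcases h2 y with rfl | rfl
  · rfl
  · exact absurd (f.map_bot.symm.trans (h.trans f.map_top)) hne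
  · exact absurd (f.map_bot.symm.trans (h.symm.trans f.map_top)) hne
  · rfl

theorem exists_bijective_hom_of_chain {S : Alg.{v}} {A : Alg.{u}} (hS : HasBooleanBounds S)
    (hA : HasBooleanBounds A) {m : S} {d : A} (hm1 : m ≠ ⊤) (hm0 : m ≠ ⊥) (hd1 : d ≠ ⊤)
    (hd0 : d ≠ ⊥) (hSm : ∀ x : S, x = ⊥ ∨ x = m ∨ x = ⊤) (hAd : ∀ x : A, x = ⊥ ∨ x = d ∨ x = ⊤)
    (hms : S.star m = ⊥) (hds : A.star d = ⊥)
    (hp : S.prime m = ⊤ ∧ A.prime d = ⊤ ∨ S.prime m = m ∧ A.prime d = d) :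
    ∃ f : Hom S A, Function.Bijective f := by
  classical
  have hbt : (⊤ : S) ≠ ⊥ := fun h => hm1 (le_antisymm le_top (h.le.trans bot_le))
  have hbt' : (⊤ : A) ≠ ⊥ := fun h => hd1 (le_antisymm le_top (h.le.trans bot_le))
  refine ⟨Hom.of (fun x => if x = ⊥ then ⊥ else if x = ⊤ then ⊤ else d) ?_ ?_ ?_ ?_ ?_ ?_, ?_, ?_⟩
  · intro x y
    rcases hSm x with rfl | rfl | rfl <;> rcases hSm y with rfl | rfl | rfl <;> simp [*]
  · intro x y
    rcases hSm x with rfl | rfl | rfl <;> rcases hSm y with rfl | rfl | rfl <;> simp [*]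
  · simp [hbt]
  · simp
  · intro x
    rcases hSm x with rfl | rfl | rfl <;>
      simp [hbt, hm0, hm1, hms, hds, hS.star_bot, hS.star_top, hA.star_bot, hA.star_top]
  · intro x
    rcases hp with hp | hp <;> rcases hSm x with rfl | rfl | rfl <;>
      simp [hbt, hm0, hm1, hp, hS.prime_bot, hS.prime_top, hA.prime_bot, hA.prime_top]
  · intro x y h
    change (if x = ⊥ then ⊥ else if x = ⊤ then ⊤ else d) =
      (if y = ⊥ then ⊥ else if y = ⊤ then ⊤ else d) at h
    rcases hSm x with rfl | rfl | rfl <;> rcases hSm y with rfl | rfl | rfl <;>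
      simp [hbt, hm0, hm1, hbt', hd0, hd1, hbt'.symm, hd0.symm, hd1.symm] at h ⊢
  · intro a
    rcases hAd a with rfl | rfl | rfl
    · exact ⟨⊥, if_pos rfl⟩
    · exact ⟨m, (if_neg hm0).trans (if_neg hm1)⟩
    · exact ⟨⊤, (if_neg hbt).trans (if_pos rfl)⟩

theorem exists_bijective_hom_from_fourDMBA {A : Alg.{u}} (hA : HasBooleanBounds A) {c d : A}
    (hc1 : c ≠ ⊤) (hc0 : c ≠ ⊥) (hcd : IsCompl c d) (hcs : A.star c = d) (hds : A.star d = c)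
    (hcp : A.prime c = c) (hdp : A.prime d = d) (hAc : ∀ x : A, x = ⊥ ∨ x = c ∨ x = d ∨ x = ⊤) :
    ∃ f : Hom fourDMBA A, Function.Bijective f := by
  have hbt : (⊥ : A) ≠ ⊤ := fun h => hc1 (le_antisymm le_top (h.ge.trans bot_le))
  have hd1 : d ≠ ⊤ := fun h => hc0 (by rw [← hds, h, hA.star_top])
  have hd0 : d ≠ ⊥ := fun h => hc1 (by rw [← hds, h, hA.star_bot])
  have hne : c ≠ d := fun h => hc0 (by have := hcd.inf_eq_bot; rwa [← h, inf_idem] at this)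
  obtain ⟨a, b, h4, hab1, hab2, ha1, hb1, ha2, hb2, ha3, hb3, ha4, hb4, hba, ht⟩ :
      ∃ a b : fourDMBA, (∀ x : fourDMBA, x = ⊥ ∨ x = a ∨ x = b ∨ x = ⊤) ∧ a ⊔ b = ⊤ ∧ a ⊓ b = ⊥ ∧
        fourDMBA.star a = b ∧ fourDMBA.star b = a ∧ fourDMBA.prime a = a ∧ fourDMBA.prime b = b ∧
        a ≠ ⊤ ∧ b ≠ ⊤ ∧ a ≠ ⊥ ∧ b ≠ ⊥ ∧ b ≠ a ∧ (⊤ : fourDMBA) ≠ ⊥ := by decide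
  have hba1 : b ⊔ a = ⊤ := by rw [sup_comm, hab1]
  have hba2 : b ⊓ a = ⊥ := by rw [inf_comm, hab2]
  have hS := IsBasic.hasBooleanBounds (Or.inr (Or.inr (Or.inr rfl)) : IsBasic fourDMBA)
  let f : fourDMBA → A := fun x => if x = ⊥ then ⊥ else if x = ⊤ then ⊤ else if x = a then c else d
  have f0 : f ⊥ = ⊥ := if_pos rfl
  have f1 : f ⊤ = ⊤ := by simp [f, ht]
  have fa : f a = c := by simp [f, *]
  have fb : f b = d := by simp [f, *]
  clear_value f
  refine ⟨Hom.of f ?_ ?_ f1 f0 ?_ ?_, ?_, ?_⟩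
  · intro x y
    rcases h4 x with rfl | rfl | rfl | rfl <;> rcases h4 y with rfl | rfl | rfl | rfl <;>
      simp [hab1, hba1, f0, f1, fa, fb, hcd.sup_eq_top, hcd.symm.sup_eq_top]
  · intro x y
    rcases h4 x with rfl | rfl | rfl | rfl <;> rcases h4 y with rfl | rfl | rfl | rfl <;>
      simp [hab2, hba2, f0, f1, fa, fb, hcd.inf_eq_bot, hcd.symm.inf_eq_bot]
  · intro x
    rcases h4 x with rfl | rfl | rfl | rfl <;>
      simp [ha1, hb1, f0, f1, fa, fb, hcs, hds, hS.star_bot, hS.star_top, hA.star_bot, hA.star_top]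
  · intro x
    rcases h4 x with rfl | rfl | rfl | rfl <;>
      simp [ha2, hb2, f0, f1, fa, fb, hcp, hdp, hS.prime_bot, hS.prime_top, hA.prime_bot,
        hA.prime_top]
  · intro x y h
    change f x = f y at h
    rcases h4 x with rfl | rfl | rfl | rfl <;> rcases h4 y with rfl | rfl | rfl | rfl <;>
      simp [f0, f1, fa, fb, hbt, hbt.symm, hc0, hc1, hd0, hd1, hc0.symm, hc1.symm, hd0.symm,
        hd1.symm, hne, hne.symm] at h ⊢
  · intro y
    rcases hAc y with rfl | rfl | rfl | rfl
    exacts [⟨⊥, f0⟩, ⟨a, fa⟩, ⟨b, fb⟩, ⟨⊤, f1⟩]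

theorem AG.exists_basic_bijective {A : Alg.{u}} (hA : A ∈ AG) (hne : (⊥ : A) ≠ ⊤)
    (hs : ∀ x : A, x ≠ ⊤ → x ⊓ A.star (A.prime x) = ⊥) :
    ∃ S : Alg.{0}, IsBasic S ∧ ∃ f : Hom S A, Function.Bijective f := by
  have hb := AG.hasBooleanBounds hA
  rcases AG.classification hA hs with h | ⟨d, hd1, hd0, hds, hdp, h⟩ |
      ⟨c, hc1, hc0, hcd, hcp, hdp, h⟩
  · refine ⟨two, Or.inl rfl, ?_⟩
    obtain ⟨f, hf⟩ := exists_injective_hom_from_two hb hne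
    refine ⟨f, hf, fun x => ?_⟩
    rcases h x with rfl | rfl
    exacts [⟨⊥, f.map_bot⟩, ⟨⊤, f.map_top⟩]
  · rcases hdp with hdp | hdp
    · have hS : IsBasic threeDS := Or.inr (Or.inl rfl)
      exact ⟨threeDS, hS, exists_bijective_hom_of_chain (m := chainDS false true)
        hS.hasBooleanBounds hb (by decide) (by decide) hd1 hd0 (by decide) h (by decide) hds
        (Or.inl ⟨by decide, hdp⟩)⟩
    · have hS : IsBasic threeKS := Or.inr (Or.inr (Or.inl rfl))
      exact ⟨threeKS, hS, exists_bijective_hom_of_chain (m := chainKS false true)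
        hS.hasBooleanBounds hb (by decide) (by decide) hd1 hd0 (by decide) h (by decide) hds
        (Or.inr ⟨by decide, hdp⟩)⟩
  · exact ⟨fourDMBA, Or.inr (Or.inr (Or.inr rfl)), exists_bijective_hom_from_fourDMBA hb hc1 hc0
      hcd rfl (hA.1.star_eq_of_isCompl hcd.symm) hcp hdp h⟩

/-! ### Simple algebras inside a variety with (TP) -/

theorem IsVariety.lift_mem {V : Set Alg.{u}} (hV : IsVariety V) {S : Alg.{0}} {A : Alg.{u}}
    (hA : A ∈ V) (f : Hom S A) (hf : Function.Injective f) : S.lift ∈ V :=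
  hV.sub_mem _ A (f.comp (Hom.down S)) (hf.comp (Hom.down_bijective S).1) hA

/-- Points of an algebra in a variety of almost Gautama algebras are separated by homomorphisms to
the simple algebras lying in that variety. -/
theorem exists_hom_basic {V : Set Alg.{u}} (hV : IsVariety V) (hAG : V ⊆ AG) {A : Alg.{u}}
    (hA : A ∈ V) {x y : A} (hxy : x ≠ y) :
    ∃ S : Alg.{0}, IsBasic S ∧ S.lift ∈ V ∧ ∃ h : Hom A S, h x ≠ h y := by
  obtain ⟨Q, f, hf, hfxy, hQ⟩ := AG.exists_simple_quotient (hAG hA) hxy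
  have hQV := hV.image_mem A Q f hf hA
  have hne : (⊥ : Q) ≠ ⊤ := fun h => hfxy <| by
    have : ∀ q : Q, q = ⊥ := fun q => le_bot_iff.1 (le_top.trans h.ge)
    rw [this (f x), this (f y)]
  obtain ⟨S, hS, e, he⟩ := AG.exists_basic_bijective (hAG hQV) hne hQ
  obtain ⟨g, hg, hg'⟩ := e.exists_inverse he
  refine ⟨S, hS, hV.lift_mem hQV e he.1, g.comp f, fun h => hfxy ?_⟩
  rw [← hg' (f x), ← hg' (f y)]
  exact congrArg e h

/-- Each simple algebra other than `two` has an element solving a system of equations that no other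
simple algebra solves, and homomorphisms preserve solutions. -/
theorem IsBasic.eq_of_hom {S T : Alg.{0}} (hS : IsBasic S) (hT : IsBasic T) (hS2 : S ≠ two)
    (f : Hom S T) : S = T := by
  have h1 : ∀ {S T : Alg.{0}} (f : Hom S T), (∃ m : S, S.star m = ⊥ ∧ S.prime m = ⊤) →
      ∃ m : T, T.star m = ⊥ ∧ T.prime m = ⊤ := fun f ⟨m, h, h'⟩ =>
    ⟨f m, by rw [← f.map_star, h, f.map_bot], by rw [← f.map_prime, h', f.map_top]⟩
  have h2 : ∀ {S T : Alg.{0}} (f : Hom S T), (∃ m : S, S.star m = ⊥ ∧ S.prime m = m) →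
      ∃ m : T, T.star m = ⊥ ∧ T.prime m = m := fun f ⟨m, h, h'⟩ =>
    ⟨f m, by rw [← f.map_star, h, f.map_bot], by rw [← f.map_prime, h']⟩
  have h3 : ∀ {S T : Alg.{0}} (f : Hom S T),
      (∃ m : S, S.prime m = m ∧ S.prime (S.star m) = S.star m) →
      ∃ m : T, T.prime m = m ∧ T.prime (T.star m) = T.star m := fun f ⟨m, h, h'⟩ =>
    ⟨f m, by rw [← f.map_prime, h], by rw [← f.map_star, ← f.map_prime, h']⟩
  rcases hS with rfl | rfl | rfl | rfl
  · exact absurd rfl hS2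
  · rcases hT with rfl | rfl | rfl | rfl
    · exact absurd (h1 f (by decide)) (by decide)
    · rfl
    · exact absurd (h1 f (by decide)) (by decide)
    · exact absurd (h1 f (by decide)) (by decide)
  · rcases hT with rfl | rfl | rfl | rfl
    · exact absurd (h2 f (by decide)) (by decide)
    · exact absurd (h2 f (by decide)) (by decide)
    · rfl
    · exact absurd (h2 f (by decide)) (by decide)
  · rcases hT with rfl | rfl | rfl | rfl
    · exact absurd (h3 f (by decide)) (by decide)
    · exact absurd (h3 f (by decide)) (by decide)
    · exact absurd (h3 f (by decide)) (by decide)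
    · rfl

/-- A variety of almost Gautama algebras with the transferability property contains at most one of
the simple algebras with more than two elements. -/
theorem eq_of_hasTP {V : Set Alg.{u}} (hV : IsVariety V) (hAG : V ⊆ AG) (hTP : HasTP V)
    {S T : Alg.{0}} (hS : IsBasic S) (hT : IsBasic T) (hS2 : S ≠ two) (hT2 : T ≠ two)
    (hSV : S.lift ∈ V) (hTV : T.lift ∈ V) : S = T := by
  obtain ⟨f, hf⟩ := exists_injective_hom_from_two hS.hasBooleanBounds hS.bot_ne_top
  obtain ⟨g⟩ := exists_hom_from_two hT.hasBooleanBounds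
  let fl : Hom (Alg.lift.{u} two) (Alg.lift.{u} S) := (f.comp (Hom.down two)).up
  have hfl : Function.Injective fl := fun x y h =>
    (Hom.down_bijective two).1 (hf (congrFun h PUnit.unit))
  obtain ⟨D, hD, f₁, g₁, hg₁, -⟩ := hTP _ (hV.sub_mem _ _ fl hfl hSV) _ hSV _ hTV fl hfl
    (g.comp (Hom.down two)).up
  obtain ⟨s, -, -⟩ := (Hom.down.{u} S).exists_inverse (Hom.down_bijective S)
  obtain ⟨t, ht, hdt⟩ := (Hom.down.{u} T).exists_inverse (Hom.down_bijective T)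
  -- The embedding of `T.lift` keeps `D` nontrivial, which is all that is needed to map `D` to a
  -- simple algebra.
  have hne : (⊥ : D) ≠ ⊤ := fun h => hT.bot_ne_top (by
    have h1 := hg₁ (g₁.map_bot.trans (h.trans g₁.map_top.symm))
    have h2 := congrArg (Hom.down T) h1
    rwa [Hom.map_bot, Hom.map_top] at h2)
  obtain ⟨R, hR, -, h, -⟩ := exists_hom_basic hV hAG hD hne
  exact (hS.eq_of_hom hR hS2 (h.comp (f₁.comp s))).trans
    (hT.eq_of_hom hR hT2 (h.comp (g₁.comp t))).symm

/-- Since `two` embeds in `S`, homomorphisms to `S` separate whatever homomorphisms to `two`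
separate. -/
theorem eq_of_lift_mem {V : Set Alg.{u}} (hV : IsVariety V) (hAG : V ⊆ AG) {S : Alg.{0}}
    (hS : IsBasic S) (hSV : S.lift ∈ V)
    (hmax : ∀ T : Alg.{0}, IsBasic T → T.lift ∈ V → T = two ∨ T = S)
    {K : Set Alg.{u}} (hK : ∀ A, A ∈ K ↔ Separated A S) : V = K := by
  refine Set.Subset.antisymm (fun A hA => (hK A).2 fun x y h => ?_)
    fun A hA => hV.mem_of_separated hSV ((hK A).1 hA)
  by_contra hxy
  obtain ⟨T, hT, hTV, k, hk⟩ := exists_hom_basic hV hAG hA hxy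
  rcases hmax T hT hTV with rfl | rfl
  · obtain ⟨f, hf⟩ := exists_injective_hom_from_two hS.hasBooleanBounds hS.bot_ne_top
    exact hk (hf (h (f.comp k)))
  · exact hk (h k)

end AlmostGautama

theorem mainTheorem2 (V : Set AlmostGautama.Alg.{u}) (hV : AlmostGautama.IsVariety V)
    (hAG : V ⊆ AlmostGautama.AG) (hnt : AlmostGautama.IsNontrivialClass V) :
    AlmostGautama.HasTP V ↔
      V ∈ ({AlmostGautama.BA, AlmostGautama.RDBLSt, AlmostGautama.RKLSt, AlmostGautama.DMBA} :
        Set (Set AlmostGautama.Alg.{u})) := by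
  open AlmostGautama in
  constructor
  · intro hTP
    have key : ∀ S : Alg.{0}, IsBasic S → S.lift ∈ V →
        (∀ T : Alg.{0}, IsBasic T → T.lift ∈ V → T = two ∨ T = S) →
        V ∈ ({BA, RDBLSt, RKLSt, DMBA} : Set (Set Alg.{u})) := by
      intro S hS hSV hmax
      have h := fun K => eq_of_lift_mem (K := K) hV hAG hS hSV hmax
      rcases hS with rfl | rfl | rfl | rfl
      · exact Or.inl (h _ BA_iff_separated)
      · exact Or.inr (Or.inl (h _ RDBLSt_iff_separated))
      · exact Or.inr (Or.inr (Or.inl (h _ RKLSt_iff_separated)))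
      · exact Or.inr (Or.inr (Or.inr (h _ DMBA_iff_separated)))
    by_cases h : ∃ S : Alg.{0}, IsBasic S ∧ S.lift ∈ V ∧ S ≠ two
    · obtain ⟨S, hS, hSV, hS2⟩ := h
      exact key S hS hSV fun T hT hTV => or_iff_not_imp_left.2 fun hT2 =>
        eq_of_hasTP hV hAG hTP hT hS hT2 hS2 hTV hSV
    -- Nontriviality of `V` still supplies a simple algebra, which must then be `two`.
    · push Not at h
      obtain ⟨A, hA, x, y, hxy⟩ := hnt
      obtain ⟨S, hS, hSV, -⟩ := exists_hom_basic hV hAG hA hxy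
      exact key S hS hSV fun T hT hTV => Or.inl (h T hT hTV)
  · rintro (rfl | rfl | rfl | rfl)
    exacts [hasTP_BA, hasTP_RDBLSt, hasTP_RKLSt, hasTP_DMBA]
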